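/- Let $B$ be a separable Banach space. Let $L$ be the class of non-degenerate $B$-valued random variables $X$ (that is, $P(X\ne 0)>0$), and let $L^2_0$ be the class of those $X\in L$ with $E\|X\|^2<\infty$ and $EX=0$. For $X\in L$ let $X_1,X_2,\dots$ be independent copies of $X$, let $S_n=\sum_{j=1}^n X_j$, and for $r>0$ let $T_r=\min\{n:\|S_n\|>r\}$ (with $T_r=\infty$ if there is no such $n$) and $$h(r)=P(\|X\|>r)+r^{-2}E\big(\|X\|^2;\|X\|\le r\big)+r^{-1}\big\|E\big(X;\|X\|\le r\big)\big\| .$$ Then the following are equivalent. (i) $B$ is of type 2: there is a constant $c\in(0,\infty)$ such that $E\|\sum_{i=1}^n X_i\|^2\le c\sum_{i=1}^n E\|X_i\|^2$ for every $n\ge 1$ and all independent $B$-valued random variables $X_1,\dots,X_n$ with $EX_i=0$ and $E\|X_i\|^2<\infty$. (ii) There is a constant $c\in(0,\infty)$ such that $E T_r\ge c/h(r)$ for all $X\in L$ and all $r>0$. (iii) There is a constant $c\in(0,\infty)$ such that $P(T_r\le n)\le c\,n\,h(r)$ for all $X\in L$, all $r>0$ and all $n\ge1$. (iv) There is a constant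 $c\in(0,\infty)$ such that $\displaystyle\liminf_{r\to\infty}\frac{E T_r}{r^2}\ge\frac{c}{E\|X\|^2}$ for all $X\in L^2_0$. (v) There is a constant $c\in(0,\infty)$ such that $\displaystyle\limsup_{r\to\infty}\,\sup_{n\ge1}\frac{r^2P(T_r\le n)}{n}\le c\,E\|X\|^2$ for all $X\in L^2_0$. Moreover, the constants may be taken to depend only on each other: for any two of these five conditions and every $c\in(0,\infty)$ there is $C\in(0,\infty)$, depending only on $c$, such that for every separable Banach space in which the first condition holds with the constant $c$, the second holds with the constant $C$. -/

import Mathlib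

universe u

namespace RandomWalkExit

open MeasureTheory ProbabilityTheory Filter

noncomputable section

/-! `X 0, X 1, …` is the sequence of steps (so `X 0` also serves as the generic step),
`P` is the underlying probability measure. -/

section Walk

variable {B : Type u} [NormedAddCommGroup B] {Ω : Type u} [MeasurableSpace Ω]

/-- The partial sums `S_n` of the first `n` steps. -/
def partialSum (X : ℕ → Ω → B) (n : ℕ) (ω : Ω) : B :=
  ∑ i ∈ Finset.range n, X i ω

/-- `T_r = min {n : ‖S_n‖ > r}`, with the value `∞` if the walk never leaves the closed ball of
radius `r`. For `r > 0` the index `n = 0` does not matter, since `S_0 = 0`. -/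
def exitTime (X : ℕ → Ω → B) (r : ℝ) (ω : Ω) : ℕ∞ :=
  ⨅ (n : ℕ) (_ : r < ‖partialSum X n ω‖), (n : ℕ∞)

/-- The expectation `E T_r`, in `[0, ∞]`. -/
def expectedExitTime (P : Measure Ω) (X : ℕ → Ω → B) (r : ℝ) : ENNReal :=
  ∫⁻ ω, (exitTime X r ω : ENNReal) ∂P

/-- `P(T_r ≤ n)`. -/
def exitProb (P : Measure Ω) (X : ℕ → Ω → B) (r : ℝ) (n : ℕ) : ℝ :=
  P.real {ω | exitTime X r ω ≤ (n : ℕ∞)}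

/-- `G(r) = P(‖Y‖ > r)`. -/
def tailFn (P : Measure Ω) (Y : Ω → B) (r : ℝ) : ℝ :=
  P.real {ω | r < ‖Y ω‖}

/-- `K(r) = r⁻² E(‖Y‖²; ‖Y‖ ≤ r)`. -/
def truncSecondMoment (P : Measure Ω) (Y : Ω → B) (r : ℝ) : ℝ :=
  (r ^ 2)⁻¹ * ∫ ω in {ω | ‖Y ω‖ ≤ r}, ‖Y ω‖ ^ 2 ∂P

/-- `M(r) = r⁻¹ E(Y; ‖Y‖ ≤ r)`, a vector of `B`. -/
def truncMean [NormedSpace ℝ B] (P : Measure Ω) (Y : Ω → B) (r : ℝ) : B :=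
  r⁻¹ • ∫ ω in {ω | ‖Y ω‖ ≤ r}, Y ω ∂P

/-- `h(r) = G(r) + K(r) + ‖M(r)‖`. -/
def pruittFn [NormedSpace ℝ B] (P : Measure Ω) (Y : Ω → B) (r : ℝ) : ℝ :=
  tailFn P Y r + truncSecondMoment P Y r + ‖truncMean P Y r‖

variable [MeasurableSpace B]

/-- Independent, identically distributed, non-degenerate (not almost surely zero) steps. -/
structure IsStepSequence (P : Measure Ω) (X : ℕ → Ω → B) : Prop where
  measurable : ∀ i, Measurable (X i)
  indep : iIndepFun X P
  identDistrib : ∀ i, IdentDistrib (X i) (X 0) P P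
  nondegenerate : ¬ (X 0 =ᵐ[P] 0)

/-- Step sequences whose step lies in `L²₀`: finite second moment and mean zero. -/
structure IsCenteredStepSequence [NormedSpace ℝ B] (P : Measure Ω) (X : ℕ → Ω → B) : Prop
    extends IsStepSequence P X where
  memLp : MemLp (X 0) 2 P
  mean_zero : ∫ ω, X 0 ω ∂P = 0

end Walk

section Conditions

variable (B : Type u) [NormedAddCommGroup B] [NormedSpace ℝ B] [MeasurableSpace B]

/-- `c` is a type 2 constant for `B`. -/
def TypeTwoWith (c : ℝ) : Prop :=
  ∀ (Ω : Type u) [MeasurableSpace Ω] (P : Measure Ω) [IsProbabilityMeasure P]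
    (n : ℕ) (X : Fin n → Ω → B),
    (∀ i, Measurable (X i)) → iIndepFun X P → (∀ i, MemLp (X i) 2 P) →
    (∀ i, ∫ ω, X i ω ∂P = 0) →
    ∫ ω, ‖∑ i, X i ω‖ ^ 2 ∂P ≤ c * ∑ i, ∫ ω, ‖X i ω‖ ^ 2 ∂P

/-- `B` is of type 2. -/
def IsTypeTwo : Prop := ∃ c : ℝ, 0 < c ∧ TypeTwoWith B c

/-- `E T_r ≥ c / h(r)` for all steps and all `r > 0`. -/
def ExpectationBound (c : ℝ) : Prop :=
  ∀ (Ω : Type u) [MeasurableSpace Ω] (P : Measure Ω) [IsProbabilityMeasure P] (X : ℕ → Ω → B),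
    IsStepSequence P X → ∀ r : ℝ, 0 < r →
      ENNReal.ofReal (c / pruittFn P (X 0) r) ≤ expectedExitTime P X r

/-- `P(T_r ≤ n) ≤ c n h(r)` for all steps, all `r > 0` and all `n ≥ 1`. -/
def ProbabilityBound (c : ℝ) : Prop :=
  ∀ (Ω : Type u) [MeasurableSpace Ω] (P : Measure Ω) [IsProbabilityMeasure P] (X : ℕ → Ω → B),
    IsStepSequence P X → ∀ r : ℝ, 0 < r → ∀ n : ℕ, 1 ≤ n →
      exitProb P X r n ≤ c * n * pruittFn P (X 0) r

/-- `liminf_{r → ∞} E T_r / r² ≥ c / E‖X‖²` for all steps in `L²₀`. -/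
def AsymptoticExpectationBound (c : ℝ) : Prop :=
  ∀ (Ω : Type u) [MeasurableSpace Ω] (P : Measure Ω) [IsProbabilityMeasure P] (X : ℕ → Ω → B),
    IsCenteredStepSequence P X →
      ENNReal.ofReal (c / ∫ ω, ‖X 0 ω‖ ^ 2 ∂P) ≤
        liminf (fun r : ℝ => expectedExitTime P X r / ENNReal.ofReal (r ^ 2)) atTop

/-- `limsup_{r → ∞} sup_{n ≥ 1} r² P(T_r ≤ n) / n ≤ c E‖X‖²` for all steps in `L²₀`; the
supremum and the upper limit are taken in `[0, ∞]`. -/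
def AsymptoticProbabilityBound (c : ℝ) : Prop :=
  ∀ (Ω : Type u) [MeasurableSpace Ω] (P : Measure Ω) [IsProbabilityMeasure P] (X : ℕ → Ω → B),
    IsCenteredStepSequence P X →
      limsup (fun r : ℝ => ⨆ (n : ℕ) (_ : 1 ≤ n),
        ENNReal.ofReal (r ^ 2 * exitProb P X r n / n)) atTop ≤
          ENNReal.ofReal (c * ∫ ω, ‖X 0 ω‖ ^ 2 ∂P)

/-- The five conditions on `B`, each with its constant. -/
def condition : Fin 5 → ℝ → Prop :=
  ![TypeTwoWith B, ExpectationBound B, ProbabilityBound B,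
    AsymptoticExpectationBound B, AsymptoticProbabilityBound B]

end Conditions

end

end RandomWalkExit

set_option linter.unusedSectionVars false

/-! Type 2 gives the bound (iii) by truncation. Cut the steps at `r` and center them. Up to time `n`
the walk leaves the ball only if some step is large, or the accumulated drift exceeds `r / 2`, or
the centered truncated walk leaves the ball of radius `r / 2`. The terms of `h` control these three
events; for the last one, Kolmogorov's maximal inequality holds in every Banach space (Jensen), and
type 2 bounds `E‖S_n‖²`. A linear bound on `P(T_r ≤ n)` bounds `E T_r` below, and `h(r) ≤ 2 E‖X‖² /
r²` for centered steps, so (iii) yields the other conditions, all of which imply (iv).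

The substantial direction is from (iv) back to type 2. Restarting the walk gives `E T_r · P(T_{2r} ≤
m) ≤ m` (`expectedExitTime_mul_measure_le`). Hence if `r²` is a suitable multiple of `m E‖X‖²`, then
(iv) makes `P(T_{2r} ≤ m)` at most `1/8`. For bounded steps, a Hoffmann-Jørgensen argument
(`lintegral_enorm_sq_partialSum_le`) turns this into `E‖S_m‖² ≤ C m E‖X‖²`.

Apply this to the walk whose step is `± x j`, with index and sign uniform. Then `S_m = ∑ N_j x_j`
with signed visit counts `N_j`. By sign symmetry the `N_j` may be replaced by `ε_j |N_j|`, and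
Jensen replaces `|N_j|` by its mean, which is the same for all `j` and at least of order `√(m / n)`.
So `m` cancels and a Rademacher type 2 inequality remains (`sum_enorm_sq_le_lintegral_signedWalk`);
symmetrization gives type 2. -/

namespace RandomWalkExit

open MeasureTheory ProbabilityTheory Filter

noncomputable section

/-! ### Exit times in terms of partial sums. -/

section ExitTime

variable {B : Type u} [NormedAddCommGroup B] {Ω : Type u}

lemma partialSum_zero (X : ℕ → Ω → B) (ω : Ω) : partialSum X 0 ω = 0 := by
  simp [partialSum]

lemma partialSum_succ (X : ℕ → Ω → B) (n : ℕ) (ω : Ω) :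
    partialSum X (n + 1) ω = partialSum X n ω + X n ω := by
  simp [partialSum, Finset.sum_range_succ]

lemma partialSum_add (X : ℕ → Ω → B) (k n : ℕ) (ω : Ω) :
    partialSum X (k + n) ω = partialSum X k ω + partialSum (fun i => X (k + i)) n ω := by
  simp [partialSum, Finset.sum_range_add]

lemma exitTime_le_iff (X : ℕ → Ω → B) (r : ℝ) (ω : Ω) (n : ℕ) :
    exitTime X r ω ≤ n ↔ ∃ j ≤ n, r < ‖partialSum X j ω‖ := by
  constructor
  · intro h
    by_contra! hn
    have : ((n + 1 : ℕ) : ℕ∞) ≤ exitTime X r ω := by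
      refine le_iInf₂ fun j hj => ?_
      have : n < j := by
        by_contra! hjn
        exact absurd hj (not_lt.2 (hn j hjn))
      exact_mod_cast this
    have := this.trans h
    norm_cast at this
    omega
  · rintro ⟨j, hj, hr⟩
    exact (iInf₂_le j hr).trans (by exact_mod_cast hj)

lemma lt_exitTime_iff (X : ℕ → Ω → B) (r : ℝ) (ω : Ω) (n : ℕ) :
    (n : ℕ∞) < exitTime X r ω ↔ ∀ j ≤ n, ‖partialSum X j ω‖ ≤ r := by
  rw [← not_le, exitTime_le_iff]
  push Not
  rfl

lemma exitTime_eq_iff (X : ℕ → Ω → B) (r : ℝ) (ω : Ω) (n : ℕ) :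
    exitTime X r ω = n ↔ r < ‖partialSum X n ω‖ ∧ ∀ j < n, ‖partialSum X j ω‖ ≤ r := by
  constructor
  · intro h
    have h1 : ∀ j < n, ‖partialSum X j ω‖ ≤ r := fun j hj =>
      (lt_exitTime_iff X r ω j).1 (by rw [h]; exact_mod_cast hj) j le_rfl
    refine ⟨?_, h1⟩
    obtain ⟨j, hj, hr⟩ := (exitTime_le_iff X r ω n).1 h.le
    rcases hj.lt_or_eq with hj | rfl
    · exact absurd (h1 j hj) (not_le.2 hr)
    · exact hr
  · rintro ⟨h1, h2⟩
    refine le_antisymm ((exitTime_le_iff X r ω n).2 ⟨n, le_rfl, h1⟩) (le_iInf₂ fun j hj => ?_)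
    have : n ≤ j := by
      by_contra! hjn
      exact absurd hj (not_lt.2 (h2 j hjn))
    exact_mod_cast this

lemma tsum_indicator_lt_eq (t : ℕ∞) :
    (∑' n : ℕ, if (n : ℕ∞) < t then (1 : ENNReal) else 0) = t := by
  induction t using ENat.recTopCoe with
  | top => simp
  | coe N =>
    rw [tsum_eq_sum (s := Finset.range N)]
    · simp [Finset.filter_true_of_mem]
    · intro b hb
      simpa using hb

end ExitTime

/-! ### Measurability, and the mean exit time as a sum of tails. -/

section Measurability

variable {B : Type u} [NormedAddCommGroup B] [MeasurableSpace B] [BorelSpace B]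
  [SecondCountableTopology B] {Ω : Type u} [MeasurableSpace Ω]

@[fun_prop]
lemma measurable_partialSum {X : ℕ → Ω → B} (hX : ∀ i, Measurable (X i)) (n : ℕ) :
    Measurable (partialSum X n) := by
  unfold partialSum
  exact Finset.measurable_fun_sum _ fun i _ => hX i

lemma measurableSet_lt_exitTime {X : ℕ → Ω → B} (hX : ∀ i, Measurable (X i)) (r : ℝ) (n : ℕ) :
    MeasurableSet {ω | (n : ℕ∞) < exitTime X r ω} := by
  simp_rw [lt_exitTime_iff]
  have : {ω | ∀ j ≤ n, ‖partialSum X j ω‖ ≤ r} = ⋂ j ∈ Set.Iic n, {ω | ‖partialSum X j ω‖ ≤ r} := by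
    ext; simp
  rw [this]
  exact MeasurableSet.biInter (Set.to_countable _) fun j _ =>
    measurableSet_le (measurable_partialSum hX j).norm measurable_const

lemma measurableSet_exitTime_le {X : ℕ → Ω → B} (hX : ∀ i, Measurable (X i)) (r : ℝ) (n : ℕ) :
    MeasurableSet {ω | exitTime X r ω ≤ n} := by
  have := (measurableSet_lt_exitTime hX r n).compl
  simpa [Set.compl_ofPred] using this

lemma measurableSet_exitTime_eq {X : ℕ → Ω → B} (hX : ∀ i, Measurable (X i)) (r : ℝ) (n : ℕ) :
    MeasurableSet {ω | exitTime X r ω = n} := by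
  simp_rw [exitTime_eq_iff]
  refine MeasurableSet.inter (measurableSet_lt measurable_const (measurable_partialSum hX n).norm) ?_
  have : {ω | ∀ j < n, ‖partialSum X j ω‖ ≤ r} = ⋂ j ∈ Set.Iio n, {ω | ‖partialSum X j ω‖ ≤ r} := by
    ext; simp
  rw [show (fun a => ∀ j < n, ‖partialSum X j a‖ ≤ r) =
    {ω | ∀ j < n, ‖partialSum X j ω‖ ≤ r} from rfl, this]
  exact MeasurableSet.biInter (Set.to_countable _) fun j _ =>
    measurableSet_le (measurable_partialSum hX j).norm measurable_const

/-- The expected exit time is the sum of its tails. -/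
lemma expectedExitTime_eq_tsum (P : Measure Ω) {X : ℕ → Ω → B} (hX : ∀ i, Measurable (X i))
    (r : ℝ) : expectedExitTime P X r = ∑' n : ℕ, P {ω | (n : ℕ∞) < exitTime X r ω} := by
  unfold expectedExitTime
  have : ∀ ω, (exitTime X r ω : ENNReal) =
      ∑' n : ℕ, {ω | (n : ℕ∞) < exitTime X r ω}.indicator 1 ω := by
    intro ω
    rw [← tsum_indicator_lt_eq (exitTime X r ω)]
    simp [Set.indicator_apply]
  simp_rw [this]
  rw [lintegral_tsum fun n =>
    (measurable_one.indicator (measurableSet_lt_exitTime hX r n)).aemeasurable]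
  congr 1 with n
  exact lintegral_indicator_one (measurableSet_lt_exitTime hX r n)

/-- A linear bound on the distribution function of the exit time bounds its mean below. -/
lemma le_expectedExitTime_of_exitProb_le (P : Measure Ω) [IsProbabilityMeasure P]
    {X : ℕ → Ω → B} (hX : ∀ i, Measurable (X i)) {r a : ℝ} (hr : 0 ≤ r) (ha : 0 < a)
    (h : ∀ n : ℕ, 1 ≤ n → exitProb P X r n ≤ n * a) :
    ENNReal.ofReal (1 / (4 * a)) ≤ expectedExitTime P X r := by
  -- Up to this time the tail is at least `1 / 2`; the `m + 1` tails `n = 0, …, m` sum to at least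
  -- `(m + 1) / 2 ≥ 1 / (4 * a)`.
  set m : ℕ := ⌊1 / (2 * a)⌋₊
  have hm1 : (m : ℝ) * a ≤ 1 / 2 := by
    have := Nat.floor_le (a := 1 / (2 * a)) (by positivity)
    calc (m : ℝ) * a ≤ 1 / (2 * a) * a := by gcongr
      _ = 1 / 2 := by field_simp
  have hm2 : 1 / (2 * a) ≤ m + 1 := (Nat.lt_floor_add_one _).le
  have key : ∀ n ∈ Finset.range (m + 1),
      ENNReal.ofReal (1 / 2) ≤ P {ω | (n : ℕ∞) < exitTime X r ω} := by
    intro n hn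
    have hn' : n ≤ m := by simpa [Nat.lt_succ_iff] using hn
    have h1 : exitProb P X r n ≤ 1 / 2 := by
      rcases Nat.eq_zero_or_pos n with rfl | hn0
      · have : {ω | exitTime X r ω ≤ ((0 : ℕ) : ℕ∞)} = ∅ := by
          ext ω
          have := (lt_exitTime_iff X r ω 0).2 (by simpa [partialSum_zero] using hr)
          simpa [pos_iff_ne_zero] using this
        unfold exitProb
        rw [this]
        simp
      · exact (h n hn0).trans (le_trans (by gcongr) hm1)
    have hc : {ω | (n : ℕ∞) < exitTime X r ω} = {ω | exitTime X r ω ≤ n}ᶜ := by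
      ext; simp
    rw [← ofReal_measureReal, hc, probReal_compl_eq_one_sub (measurableSet_exitTime_le hX r n)]
    apply ENNReal.ofReal_le_ofReal
    unfold exitProb at h1
    linarith
  rw [expectedExitTime_eq_tsum P hX]
  refine le_trans ?_ (ENNReal.sum_le_tsum (Finset.range (m + 1)))
  refine le_trans ?_ (Finset.sum_le_sum key)
  rw [Finset.sum_const, Finset.card_range, nsmul_eq_mul, ← ENNReal.ofReal_natCast,
    ← ENNReal.ofReal_mul (by positivity)]
  apply ENNReal.ofReal_le_ofReal
  push_cast
  calc 1 / (4 * a) = 1 / (2 * a) * (1 / 2) := by field_simp; norm_num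
    _ ≤ _ := by gcongr

end Measurability

/-! ### Positivity of `h`, and its size for centered steps. -/

section PruittFn

variable {B : Type u} [NormedAddCommGroup B] [NormedSpace ℝ B] [MeasurableSpace B] [BorelSpace B]
  [SecondCountableTopology B] {Ω : Type u} [MeasurableSpace Ω]

lemma tailFn_nonneg (P : Measure Ω) (Y : Ω → B) (r : ℝ) : 0 ≤ tailFn P Y r :=
  measureReal_nonneg

lemma truncSecondMoment_nonneg (P : Measure Ω) (Y : Ω → B) (r : ℝ) :
    0 ≤ truncSecondMoment P Y r :=
  mul_nonneg (by positivity) (integral_nonneg fun _ => by positivity)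

lemma measurableSet_norm_le {Y : Ω → B} (hY : Measurable Y) (r : ℝ) :
    MeasurableSet {ω | ‖Y ω‖ ≤ r} :=
  measurableSet_le hY.norm measurable_const

lemma integrableOn_norm_sq_of_norm_le (P : Measure Ω) [IsFiniteMeasure P] {Y : Ω → B}
    (hY : Measurable Y) (r : ℝ) : IntegrableOn (fun ω => ‖Y ω‖ ^ 2) {ω | ‖Y ω‖ ≤ r} P := by
  refine Integrable.of_bound (C := r ^ 2) (hY.norm.pow_const 2).aestronglyMeasurable ?_
  refine (ae_restrict_iff' (measurableSet_norm_le hY r)).2 (ae_of_all _ fun ω hω => ?_)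
  simp only [Set.mem_ofPred_eq] at hω
  rw [Real.norm_of_nonneg (by positivity)]
  gcongr

/-- If `G(r)` and `K(r)` both vanish, the step is zero almost surely. This keeps `c / h(r)` a
genuine quotient. -/
lemma pruittFn_pos (P : Measure Ω) [IsProbabilityMeasure P] {Y : Ω → B} (hY : Measurable Y)
    (hnd : ¬ (Y =ᵐ[P] 0)) {r : ℝ} (hr : 0 < r) : 0 < pruittFn P Y r := by
  by_contra! hle
  have h1 := tailFn_nonneg P Y r
  have h2 := truncSecondMoment_nonneg P Y r
  have h3 := norm_nonneg (truncMean P Y r)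
  unfold pruittFn at hle
  have hG : tailFn P Y r = 0 := by linarith
  have hK : truncSecondMoment P Y r = 0 := by linarith
  apply hnd
  have hG' : ∀ᵐ ω ∂P, ‖Y ω‖ ≤ r := by
    unfold tailFn at hG
    rw [measureReal_eq_zero_iff] at hG
    rw [ae_iff]
    simpa using hG
  unfold truncSecondMoment at hK
  have hK' : ∫ ω in {ω | ‖Y ω‖ ≤ r}, ‖Y ω‖ ^ 2 ∂P = 0 := by
    rcases mul_eq_zero.1 hK with h | h
    · exact absurd h (by positivity)
    · exact h
  rw [integral_eq_zero_iff_of_nonneg (fun _ => by positivity)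
    (integrableOn_norm_sq_of_norm_le P hY r)] at hK'
  have := (ae_restrict_iff' (measurableSet_norm_le hY r)).1 hK'
  filter_upwards [hG', this] with ω h1 h2
  simpa using h2 h1

/-- For a centered step, `h(r) ≤ 2 E‖X‖² / r²`. -/
lemma pruittFn_le_of_centered (P : Measure Ω) [IsProbabilityMeasure P] {Y : Ω → B}
    (hY : Measurable Y) (h2 : MemLp Y 2 P) (h0 : ∫ ω, Y ω ∂P = 0) {r : ℝ} (hr : 0 < r) :
    pruittFn P Y r ≤ 2 * (∫ ω, ‖Y ω‖ ^ 2 ∂P) / r ^ 2 := by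
  set A : Set Ω := {ω | ‖Y ω‖ ≤ r} with hA
  have hAm : MeasurableSet A := measurableSet_norm_le hY r
  have hi2 : Integrable (fun ω => ‖Y ω‖ ^ 2) P := h2.norm.integrable_sq
  have hi : Integrable Y P := h2.integrable one_le_two
  have hAc : {ω | r < ‖Y ω‖} = Aᶜ := by ext; simp [hA]
  have hsplit := integral_add_compl hAm hi2
  have hG : tailFn P Y r ≤ (r ^ 2)⁻¹ * ∫ ω in Aᶜ, ‖Y ω‖ ^ 2 ∂P := by
    unfold tailFn
    rw [hAc, ← div_eq_inv_mul, le_div_iff₀ (by positivity)]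
    have := setIntegral_mono_on (μ := P) (s := Aᶜ) (f := fun _ => r ^ 2)
      (g := fun ω => ‖Y ω‖ ^ 2) (integrable_const _) hi2.integrableOn hAm.compl (by
        intro ω hω
        have : r < ‖Y ω‖ := by simpa [hA] using hω
        gcongr)
    simpa using this
  -- Mean zero trades the integral over `‖Y‖ ≤ r` for the one over `‖Y‖ > r`, where `‖Y‖ ≤ ‖Y‖² /
  -- r`. So `G` and `‖M‖` each cost one tail of the second moment, and `K` is exactly the remaining
  -- part.
  have hM : ‖truncMean P Y r‖ ≤ (r ^ 2)⁻¹ * ∫ ω in Aᶜ, ‖Y ω‖ ^ 2 ∂P := by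
    unfold truncMean
    have hs := integral_add_compl hAm hi
    rw [h0] at hs
    rw [norm_smul, eq_neg_of_add_eq_zero_left hs, norm_neg, Real.norm_of_nonneg (by positivity)]
    calc r⁻¹ * ‖∫ ω in Aᶜ, Y ω ∂P‖ ≤ r⁻¹ * ∫ ω in Aᶜ, ‖Y ω‖ ∂P := by
          gcongr; exact norm_integral_le_integral_norm _
      _ ≤ r⁻¹ * ∫ ω in Aᶜ, r⁻¹ * ‖Y ω‖ ^ 2 ∂P := by
          refine mul_le_mul_of_nonneg_left ?_ (by positivity)
          refine setIntegral_mono_on hi.norm.integrableOn (hi2.const_mul _).integrableOn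
            hAm.compl fun ω hω => ?_
          have : r < ‖Y ω‖ := by simpa [hA] using hω
          rw [← div_eq_inv_mul, le_div_iff₀ hr, sq]
          gcongr
      _ = _ := by rw [integral_const_mul]; ring
  have hB : ∫ ω in Aᶜ, ‖Y ω‖ ^ 2 ∂P ≤ ∫ ω, ‖Y ω‖ ^ 2 ∂P :=
    setIntegral_le_integral hi2 (ae_of_all _ fun _ => by positivity)
  unfold pruittFn truncSecondMoment
  have hr2 : 0 < (r ^ 2)⁻¹ := by positivity
  rw [div_eq_inv_mul]
  nlinarith [mul_le_mul_of_nonneg_left hB hr2.le]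

lemma integral_norm_sq_pos (P : Measure Ω) {Y : Ω → B} (h2 : MemLp Y 2 P)
    (hnd : ¬ (Y =ᵐ[P] 0)) : 0 < ∫ ω, ‖Y ω‖ ^ 2 ∂P := by
  refine lt_of_le_of_ne (integral_nonneg fun _ => by positivity) fun h => hnd ?_
  have := (integral_eq_zero_iff_of_nonneg (fun _ => by positivity) h2.norm.integrable_sq).1 h.symm
  filter_upwards [this] with ω hω
  simpa using hω

end PruittFn

/-! ### The elementary implications: (iii) to (ii) to (iv), and (iii) to (v) to (iv). -/

section Implications

variable {B : Type u} [NormedAddCommGroup B] [NormedSpace ℝ B] [MeasurableSpace B] [BorelSpace B]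
  [SecondCountableTopology B]

lemma ProbabilityBound.expectationBound {c : ℝ} (hc : 0 < c) (h : ProbabilityBound B c) :
    ExpectationBound B (1 / (4 * c)) := by
  intro Ω _ P _ X hX r hr
  have hpos := pruittFn_pos P (hX.measurable 0) hX.nondegenerate hr
  have := le_expectedExitTime_of_exitProb_le P hX.measurable hr.le (mul_pos hc hpos)
    fun n hn => (h Ω P X hX r hr n hn).trans_eq (by ring)
  convert this using 2
  field_simp

lemma ExpectationBound.asymptotic {c : ℝ} (hc : 0 < c) (h : ExpectationBound B c) :
    AsymptoticExpectationBound B (c / 2) := by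
  intro Ω _ P _ X hX
  refine le_liminf_of_le (by isBoundedDefault) ?_
  filter_upwards [eventually_gt_atTop 0] with r hr
  have hσ := integral_norm_sq_pos P hX.memLp hX.nondegenerate
  have hpos := pruittFn_pos P (hX.measurable 0) hX.nondegenerate hr
  have hle := pruittFn_le_of_centered P (hX.measurable 0) hX.memLp hX.mean_zero hr
  rw [ENNReal.le_div_iff_mul_le (by simp [hr.ne']) (by simp), ← ENNReal.ofReal_mul (by positivity)]
  refine le_trans (ENNReal.ofReal_le_ofReal ?_) (h Ω P X hX.toIsStepSequence r hr)
  calc _ = c / (2 * (∫ ω, ‖X 0 ω‖ ^ 2 ∂P) / r ^ 2) := by field_simp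
    _ ≤ _ := by gcongr

lemma ProbabilityBound.asymptotic {c : ℝ} (hc : 0 < c) (h : ProbabilityBound B c) :
    AsymptoticProbabilityBound B (2 * c) := by
  intro Ω _ P _ X hX
  refine limsup_le_of_le (by isBoundedDefault) ?_
  filter_upwards [eventually_gt_atTop 0] with r hr
  have hle := pruittFn_le_of_centered P (hX.measurable 0) hX.memLp hX.mean_zero hr
  refine iSup₂_le fun n hn => ENNReal.ofReal_le_ofReal ?_
  have hn0 : (0 : ℝ) < n := by exact_mod_cast hn
  calc r ^ 2 * exitProb P X r n / n
      ≤ r ^ 2 * (c * n * (2 * (∫ ω, ‖X 0 ω‖ ^ 2 ∂P) / r ^ 2)) / n := by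
        gcongr
        exact (h Ω P X hX.toIsStepSequence r hr n hn).trans (by gcongr)
    _ = _ := by field_simp

lemma AsymptoticProbabilityBound.asymptoticExpectationBound {c : ℝ} (hc : 0 < c)
    (h : AsymptoticProbabilityBound B c) : AsymptoticExpectationBound B (1 / (8 * c)) := by
  intro Ω _ P _ X hX
  have hσ := integral_norm_sq_pos P hX.memLp hX.nondegenerate
  set σ := ∫ ω, ‖X 0 ω‖ ^ 2 ∂P
  -- Doubling the constant makes the inequality strict, so that it holds eventually before the
  -- limit.
  have hlt : limsup (fun r : ℝ => ⨆ (n : ℕ) (_ : 1 ≤ n),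
      ENNReal.ofReal (r ^ 2 * exitProb P X r n / n)) atTop < ENNReal.ofReal (2 * c * σ) :=
    (h Ω P X hX).trans_lt <| (ENNReal.ofReal_lt_ofReal_iff (by positivity)).2 (by
      show c * σ < _
      nlinarith [mul_pos hc hσ])
  refine le_liminf_of_le (by isBoundedDefault) ?_
  filter_upwards [eventually_gt_atTop 0, eventually_lt_of_limsup_lt hlt] with r hr hr'
  have key := le_expectedExitTime_of_exitProb_le P hX.measurable hr.le
    (a := 2 * c * σ / r ^ 2) (by positivity) fun n hn => by
      have hn0 : (0 : ℝ) < n := by exact_mod_cast hn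
      have h1 := (le_iSup₂ (f := fun (n : ℕ) (_ : 1 ≤ n) =>
        ENNReal.ofReal (r ^ 2 * exitProb P X r n / n)) n hn).trans hr'.le
      rw [ENNReal.ofReal_le_ofReal_iff (by positivity), div_le_iff₀ hn0] at h1
      rw [mul_div_assoc', le_div_iff₀ (by positivity)]
      linarith
  rw [ENNReal.le_div_iff_mul_le (by simp [hr.ne']) (by simp), ← ENNReal.ofReal_mul (by positivity)]
  convert key using 2
  field_simp
  norm_num

end Implications

/-! ### Jensen's inequality and independent centered increments. -/

section Jensen

/-- The square of an integral is at most the integral of the square. -/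
lemma lintegral_sq_le {α : Type*} [MeasurableSpace α] (μ : Measure α) [IsProbabilityMeasure μ]
    {f : α → ENNReal} (hf : AEMeasurable f μ) : (∫⁻ a, f a ∂μ) ^ 2 ≤ ∫⁻ a, f a ^ 2 ∂μ := by
  have h := ENNReal.lintegral_mul_le_Lp_mul_Lq μ Real.HolderConjugate.two_two hf
    (aemeasurable_const (b := (1 : ENNReal)))
  simp only [Pi.mul_apply, mul_one, ENNReal.one_rpow, lintegral_const, measure_univ] at h
  calc (∫⁻ a, f a ∂μ) ^ 2 ≤ ((∫⁻ a, f a ^ (2 : ℝ) ∂μ) ^ (1 / 2 : ℝ)) ^ 2 := by gcongr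
    _ = ∫⁻ a, f a ^ 2 ∂μ := by
      rw [← ENNReal.rpow_natCast, ← ENNReal.rpow_mul]
      norm_num

variable {B : Type*} [NormedAddCommGroup B] [NormedSpace ℝ B] [CompleteSpace B] [MeasurableSpace B]
  [BorelSpace B] [SecondCountableTopology B] {Ω : Type*} [MeasurableSpace Ω]

/-- Jensen applied to `b + V`, whose mean is `b`. -/
lemma enorm_sq_le_lintegral_add (μ : Measure Ω) [IsProbabilityMeasure μ] {V : Ω → B}
    (hi : Integrable V μ) (h0 : ∫ ω, V ω ∂μ = 0) (b : B) :
    ‖b‖ₑ ^ 2 ≤ ∫⁻ ω, ‖b + V ω‖ₑ ^ 2 ∂μ := by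
  have hb : b = ∫ ω, (b + V ω) ∂μ := by
    rw [integral_add (integrable_const b) hi, h0]
    simp
  calc ‖b‖ₑ ^ 2 = ‖∫ ω, (b + V ω) ∂μ‖ₑ ^ 2 := by rw [← hb]
    _ ≤ (∫⁻ ω, ‖b + V ω‖ₑ ∂μ) ^ 2 := by
      gcongr; exact enorm_integral_le_lintegral_enorm _
    _ ≤ _ := lintegral_sq_le μ ((integrable_const b).add hi).aestronglyMeasurable.enorm

/-- Adding an independent centered vector increases second moments, also on an event that is
independent of it. -/
lemma setLIntegral_enorm_sq_le_add {γ : Type*} [MeasurableSpace γ] (P : Measure Ω)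
    [IsProbabilityMeasure P] {Y : Ω → γ} {V : Ω → B} (hY : Measurable Y) (hV : Measurable V)
    (hind : IndepFun Y V P) (hi : Integrable V P) (h0 : ∫ ω, V ω ∂P = 0) {A : Set γ}
    (hA : MeasurableSet A) {f : γ → B} (hf : Measurable f) :
    ∫⁻ ω in Y ⁻¹' A, ‖f (Y ω)‖ₑ ^ 2 ∂P ≤ ∫⁻ ω in Y ⁻¹' A, ‖f (Y ω) + V ω‖ₑ ^ 2 ∂P := by
  have hp := (indepFun_iff_map_prod_eq_prod_map_map hY.aemeasurable hV.aemeasurable).1 hind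
  have : IsProbabilityMeasure (P.map V) := Measure.isProbabilityMeasure_map hV.aemeasurable
  have : IsProbabilityMeasure (P.map Y) := Measure.isProbabilityMeasure_map hY.aemeasurable
  have hiV : Integrable (fun v => v) (P.map V) :=
    (integrable_map_measure aestronglyMeasurable_id hV.aemeasurable).2 hi
  have h0V : ∫ v, v ∂(P.map V) = 0 := by
    rw [← h0]; exact integral_map hV.aemeasurable aestronglyMeasurable_id
  have hm : Measurable fun p : γ × B => A.indicator 1 p.1 * ‖f p.1 + p.2‖ₑ ^ 2 := by
    have : Measurable (A.indicator (1 : γ → ENNReal)) := measurable_one.indicator hA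
    fun_prop
  have hm1 : Measurable fun y : γ => A.indicator 1 y * ‖f y‖ₑ ^ 2 := by
    have : Measurable (A.indicator (1 : γ → ENNReal)) := measurable_one.indicator hA
    fun_prop
  have hrw : ∀ g : Ω → ENNReal, ∫⁻ ω in Y ⁻¹' A, g ω ∂P = ∫⁻ ω, A.indicator 1 (Y ω) * g ω ∂P := by
    intro g
    rw [← lintegral_indicator (hY hA)]
    congr 1 with ω
    by_cases h : Y ω ∈ A <;> simp [Set.indicator, h]
  -- Independence turns the joint law into a product, so the claim reduces to the previous
  -- inequality with `Y` frozen at `y`.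
  rw [hrw, hrw, ← lintegral_map hm1 hY,
    ← lintegral_map (g := fun ω => (Y ω, V ω)) hm (hY.prodMk hV), hp,
    lintegral_prod _ hm.aemeasurable]
  refine lintegral_mono fun y => ?_
  simp only
  rw [lintegral_const_mul _ (by fun_prop)]
  gcongr
  exact enorm_sq_le_lintegral_add _ hiV h0V _

lemma lintegral_enorm_sq_le_add (P : Measure Ω)
    [IsProbabilityMeasure P] {U V : Ω → B} (hU : Measurable U) (hV : Measurable V)
    (hind : IndepFun U V P) (hi : Integrable V P) (h0 : ∫ ω, V ω ∂P = 0) :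
    ∫⁻ ω, ‖U ω‖ₑ ^ 2 ∂P ≤ ∫⁻ ω, ‖U ω + V ω‖ₑ ^ 2 ∂P := by
  simpa using setLIntegral_enorm_sq_le_add P hU hV hind hi h0 MeasurableSet.univ measurable_id

end Jensen

/-! ### The Markov property of the walk and geometric decay of exit time tails. -/

section Markov

variable {B : Type u} [NormedAddCommGroup B] [MeasurableSpace B]
  [BorelSpace B] [SecondCountableTopology B] {Ω : Type u} [MeasurableSpace Ω]

/-- The first `k` steps of a walk. -/
def firstSteps (X : ℕ → Ω → B) (k : ℕ) (ω : Ω) : Fin k → B := fun i => X i ω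

/-- The walk which has prescribed first `k` steps and then stops. -/
def stoppedSteps (k : ℕ) (i : ℕ) (w : Fin k → B) : B := if h : i < k then w ⟨i, h⟩ else 0

@[fun_prop]
lemma measurable_firstSteps {X : ℕ → Ω → B} (hX : ∀ i, Measurable (X i)) (k : ℕ) :
    Measurable (firstSteps X k) :=
  measurable_pi_lambda _ fun i => hX i

@[fun_prop]
lemma measurable_stoppedSteps (k i : ℕ) : Measurable (stoppedSteps (B := B) k i) := by
  unfold stoppedSteps
  split_ifs <;> fun_prop

lemma partialSum_stoppedSteps (X : ℕ → Ω → B) {j k : ℕ} (hjk : j ≤ k) (ω : Ω) :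
    partialSum (stoppedSteps k) j (firstSteps X k ω) = partialSum X j ω := by
  unfold partialSum
  refine Finset.sum_congr rfl fun i hi => ?_
  have : i < k := (Finset.mem_range.1 hi).trans_le hjk
  simp [stoppedSteps, firstSteps, this]

/-- Whether the exit happens at time `k` is decided by the first `k` steps, so the event is
independent of the later ones. Since `stoppedSteps k` is itself a walk on the space `Fin k → B`,
measurability of the set on the right comes from the general results on exit times. -/
lemma setOf_exitTime_eq (X : ℕ → Ω → B) (r : ℝ) (k : ℕ) :
    {ω | exitTime X r ω = k} = firstSteps X k ⁻¹' {w | exitTime (stoppedSteps k) r w = k} := by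
  ext ω
  simp only [Set.mem_ofPred_eq, Set.mem_preimage, exitTime_eq_iff]
  rw [partialSum_stoppedSteps X le_rfl]
  exact and_congr_right fun _ => forall₂_congr fun j hj => by
    rw [partialSum_stoppedSteps X hj.le]

lemma setOf_lt_exitTime_eq (X : ℕ → Ω → B) (r : ℝ) (k : ℕ) :
    {ω | (k : ℕ∞) < exitTime X r ω} =
      firstSteps X k ⁻¹' {w | (k : ℕ∞) < exitTime (stoppedSteps k) r w} := by
  ext ω
  simp only [Set.mem_ofPred_eq, Set.mem_preimage, lt_exitTime_iff]
  exact forall₂_congr fun j hj => by rw [partialSum_stoppedSteps X hj]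

lemma indepFun_firstSteps {P : Measure Ω} {X : ℕ → Ω → B} (hX : ∀ i, Measurable (X i))
    (hind : iIndepFun X P) (k m : ℕ) :
    IndepFun (firstSteps X k) (firstSteps (fun i => X (k + i)) m) P := by
  have h := hind.indepFun_finset (Finset.range k) (Finset.Ico k (k + m)) (by
    rw [Finset.disjoint_left]
    intro i hi
    simp only [Finset.mem_range, Finset.mem_Ico] at *
    omega) hX
  have hφ : Measurable fun (w : Finset.range k → B) (i : Fin k) =>
      w ⟨i, Finset.mem_range.2 i.2⟩ := by fun_prop
  have hψ : Measurable fun (w : Finset.Ico k (k + m) → B) (i : Fin m) =>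
      w ⟨k + i, Finset.mem_Ico.2 ⟨by omega, by omega⟩⟩ := by fun_prop
  exact h.comp hφ hψ

lemma identDistrib_shift {P : Measure Ω} {X : ℕ → Ω → B}
    (hind : iIndepFun X P) (hid : ∀ i, IdentDistrib (X i) (X 0) P P) (k m : ℕ) :
    IdentDistrib (firstSteps (fun i => X (k + i)) m) (firstSteps X m) P P := by
  refine IdentDistrib.pi (X := fun (i : Fin m) => X (k + i)) (Y := fun (i : Fin m) => X i)
    (fun i => (hid _).trans (hid _).symm)
    (hind.precomp fun i j h => ?_) (hind.precomp fun i j h => ?_)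
  · simpa [Fin.ext_iff] using h
  · simpa [Fin.ext_iff] using h

lemma indepFun_firstSteps_partialSum {P : Measure Ω} {X : ℕ → Ω → B}
    (hX : ∀ i, Measurable (X i)) (hind : iIndepFun X P) (k m : ℕ) :
    IndepFun (firstSteps X k) (partialSum (fun i => X (k + i)) m) P := by
  have hm : Measurable (partialSum (stoppedSteps (B := B) m) m) := by fun_prop
  have h := (indepFun_firstSteps hX hind k m).comp measurable_id hm
  convert h using 1
  · rfl
  ext ω
  exact (partialSum_stoppedSteps (B := B) _ le_rfl ω).symm

lemma identDistrib_partialSum_shift {P : Measure Ω} {X : ℕ → Ω → B}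
    (hind : iIndepFun X P) (hid : ∀ i, IdentDistrib (X i) (X 0) P P) (k m : ℕ) :
    IdentDistrib (partialSum (fun i => X (k + i)) m) (partialSum X m) P P := by
  have hm : Measurable (partialSum (stoppedSteps (B := B) m) m) := by fun_prop
  have h := (identDistrib_shift hind hid k m).comp hm
  convert h using 1
  · ext ω
    exact (partialSum_stoppedSteps (B := B) _ le_rfl ω).symm
  · ext ω
    exact (partialSum_stoppedSteps (B := B) _ le_rfl ω).symm

/-- To stay in the ball of radius `r` the walk must, after any time, stay in the ball of radius
`2 r` around its position. -/
lemma measure_lt_exitTime_add_le {P : Measure Ω} {X : ℕ → Ω → B} (hX : ∀ i, Measurable (X i))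
    (hind : iIndepFun X P) (hid : ∀ i, IdentDistrib (X i) (X 0) P P) (r : ℝ) (k m : ℕ) :
    P {ω | ((k + m : ℕ) : ℕ∞) < exitTime X r ω} ≤
      P {ω | (k : ℕ∞) < exitTime X r ω} * P {ω | (m : ℕ∞) < exitTime X (2 * r) ω} := by
  have hAm : MeasurableSet {w : Fin m → B | (m : ℕ∞) < exitTime (stoppedSteps m) (2 * r) w} :=
    measurableSet_lt_exitTime (measurable_stoppedSteps m) _ _
  have hAk : MeasurableSet {w : Fin k → B | (k : ℕ∞) < exitTime (stoppedSteps k) r w} :=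
    measurableSet_lt_exitTime (measurable_stoppedSteps k) _ _
  -- Two points of the ball of radius `r` differ by at most `2 r`.
  have hsub : {ω | ((k + m : ℕ) : ℕ∞) < exitTime X r ω} ⊆ {ω | (k : ℕ∞) < exitTime X r ω} ∩
      {ω | (m : ℕ∞) < exitTime (fun i => X (k + i)) (2 * r) ω} := by
    intro ω hω
    simp only [Set.mem_inter_iff, Set.mem_ofPred_eq, lt_exitTime_iff] at hω ⊢
    refine ⟨fun j hj => hω j (by omega), fun j hj => ?_⟩
    have h1 := hω (k + j) (by omega)
    have h2 := hω k (by omega)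
    rw [partialSum_add] at h1
    have h3 := norm_sub_le (partialSum X k ω + partialSum (fun i => X (k + i)) j ω)
      (partialSum X k ω)
    rw [add_sub_cancel_left] at h3
    linarith
  refine (measure_mono hsub).trans ?_
  rw [setOf_lt_exitTime_eq X r k, setOf_lt_exitTime_eq (fun i => X (k + i)) (2 * r) m,
    setOf_lt_exitTime_eq X (2 * r) m,
    (indepFun_firstSteps hX hind k m).measure_inter_preimage_eq_mul _ _ hAk hAm,
    (identDistrib_shift hind hid k m).measure_mem_eq hAm]

/-- Peel off blocks of `m` steps from the end. Only the peeled block is measured with radius `2 r`;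
the initial piece keeps `r`, so the radius does not grow with `k`. -/
lemma measure_mul_lt_exitTime_le {P : Measure Ω} [IsProbabilityMeasure P] {X : ℕ → Ω → B}
    (hX : ∀ i, Measurable (X i))
    (hind : iIndepFun X P) (hid : ∀ i, IdentDistrib (X i) (X 0) P P) (r : ℝ) (k m : ℕ) :
    P {ω | ((m * k : ℕ) : ℕ∞) < exitTime X r ω} ≤
      P {ω | (m : ℕ∞) < exitTime X (2 * r) ω} ^ k := by
  induction k with
  | zero => simpa using prob_le_one
  | succ k ih =>
    rw [Nat.mul_succ, pow_succ]
    exact (measure_lt_exitTime_add_le hX hind hid r _ m).trans (mul_le_mul_left ih _)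

/-- `E T_r · P(T_{2r} ≤ m) ≤ m`. -/
lemma expectedExitTime_mul_measure_le {P : Measure Ω} [IsProbabilityMeasure P] {X : ℕ → Ω → B}
    (hX : ∀ i, Measurable (X i))
    (hind : iIndepFun X P) (hid : ∀ i, IdentDistrib (X i) (X 0) P P) (r : ℝ) {m : ℕ} (hm : 0 < m) :
    expectedExitTime P X r * P {ω | exitTime X (2 * r) ω ≤ m} ≤ m := by
  have : NeZero m := ⟨hm.ne'⟩
  have hc : P {ω | exitTime X (2 * r) ω ≤ m} = 1 - P {ω | (m : ℕ∞) < exitTime X (2 * r) ω} := by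
    rw [← prob_compl_eq_one_sub (measurableSet_lt_exitTime hX _ _)]
    congr 1; ext; simp
  set q := P {ω | (m : ℕ∞) < exitTime X (2 * r) ω}
  have h1 : expectedExitTime P X r ≤ m * (1 - q)⁻¹ := by
    -- Writing `n = m k + i` with `i < m`, every tail in the block `k` is at most `q ^ k`; the
    -- geometric series gives `m / (1 - q)`.
    rw [expectedExitTime_eq_tsum P hX, ← (Nat.divModEquiv m).symm.tsum_eq, ← ENNReal.tsum_geometric,
      ENNReal.tsum_prod', ← ENNReal.tsum_mul_left]
    refine ENNReal.tsum_le_tsum fun k => ?_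
    rw [tsum_fintype]
    refine (Finset.sum_le_card_nsmul _ _ (q ^ k) fun i _ => ?_).trans_eq (by simp)
    refine (measure_mono ?_).trans (measure_mul_lt_exitTime_le hX hind hid r k m)
    intro ω hω
    simp only [Set.mem_ofPred_eq] at hω ⊢
    refine lt_of_le_of_lt ?_ hω
    simp [Nat.divModEquiv]
    norm_cast
    rw [mul_comm]
    omega
  rw [hc]
  calc expectedExitTime P X r * (1 - q) ≤ m * (1 - q)⁻¹ * (1 - q) := by gcongr
    _ = m * ((1 - q)⁻¹ * (1 - q)) := mul_assoc _ _ _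
    -- Only an inequality, because for `q = 1` the product is `⊤ * 0 = 0`.
    _ ≤ m * 1 := by gcongr; exact ENNReal.inv_mul_le_one _
    _ = m := mul_one _

lemma setOf_exitTime_le_eq_iUnion (X : ℕ → Ω → B) (r : ℝ) (n : ℕ) :
    {ω | exitTime X r ω ≤ n} = ⋃ k ∈ Finset.range (n + 1), {ω | exitTime X r ω = k} := by
  ext ω
  simp only [Set.mem_ofPred_eq, Set.mem_iUnion, Finset.mem_range, exists_prop, Nat.lt_succ_iff]
  constructor
  · intro h
    obtain ⟨k, hk⟩ := ENat.ne_top_iff_exists.1 (ne_top_of_le_ne_top (ENat.natCast_ne_top n) h)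
    rw [← hk] at h ⊢
    exact ⟨k, by exact_mod_cast h, rfl⟩
  · rintro ⟨k, hk, h⟩
    rw [h]
    exact_mod_cast hk

lemma setLIntegral_exitTime_le {P : Measure Ω} {X : ℕ → Ω → B} (hX : ∀ i, Measurable (X i))
    (r : ℝ) (n : ℕ) (f : Ω → ENNReal) :
    ∫⁻ ω in {ω | exitTime X r ω ≤ n}, f ω ∂P =
      ∑ k ∈ Finset.range (n + 1), ∫⁻ ω in {ω | exitTime X r ω = k}, f ω ∂P := by
  rw [setOf_exitTime_le_eq_iUnion]
  refine lintegral_biUnion_finset ?_ (fun k _ => measurableSet_exitTime_eq hX r k) f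
  intro i _ j _ hij
  refine Set.disjoint_left.2 fun ω h1 h2 => hij ?_
  simp only [Set.mem_ofPred_eq] at h1 h2
  exact_mod_cast h1.symm.trans h2

end Markov

/-! ### Maximal inequalities of Kolmogorov and Hoffmann-Jørgensen type. -/

section Maximal

variable {B : Type u} [NormedAddCommGroup B] [NormedSpace ℝ B] [CompleteSpace B] [MeasurableSpace B]
  [BorelSpace B] [SecondCountableTopology B] {Ω : Type u} [MeasurableSpace Ω]

lemma integrable_partialSum {P : Measure Ω} {X : ℕ → Ω → B} (hi : ∀ i, Integrable (X i) P) (n : ℕ) :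
    Integrable (partialSum X n) P :=
  integrable_finsetSum _ fun i _ => hi i

lemma integral_partialSum_eq_zero {P : Measure Ω} {X : ℕ → Ω → B} (hi : ∀ i, Integrable (X i) P)
    (h0 : ∀ i, ∫ ω, X i ω ∂P = 0) (n : ℕ) : ∫ ω, partialSum X n ω ∂P = 0 := by
  unfold partialSum
  rw [integral_finsetSum _ fun i _ => hi i]
  simp [h0]

/-- Kolmogorov's maximal inequality in a Banach space. -/
lemma sq_mul_measure_exitTime_le {P : Measure Ω} [IsProbabilityMeasure P] {X : ℕ → Ω → B}
    (hX : ∀ i, Measurable (X i)) (hind : iIndepFun X P) (hi : ∀ i, Integrable (X i) P)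
    (h0 : ∀ i, ∫ ω, X i ω ∂P = 0) {s : ℝ} (hs : 0 ≤ s) (n : ℕ) :
    ENNReal.ofReal (s ^ 2) * P {ω | exitTime X s ω ≤ n} ≤ ∫⁻ ω, ‖partialSum X n ω‖ₑ ^ 2 ∂P := by
  rw [← setLIntegral_const]
  refine le_trans ?_ (setLIntegral_le_lintegral {ω | exitTime X s ω ≤ n} _)
  rw [setLIntegral_exitTime_le hX, setLIntegral_exitTime_le hX]
  refine Finset.sum_le_sum fun k hk => ?_
  have hk' : k ≤ n := by simpa [Nat.lt_succ_iff] using hk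
  obtain ⟨m, rfl⟩ := Nat.exists_eq_add_of_le hk'
  calc ∫⁻ _ in {ω | exitTime X s ω = k}, ENNReal.ofReal (s ^ 2) ∂P
      ≤ ∫⁻ ω in {ω | exitTime X s ω = k}, ‖partialSum X k ω‖ₑ ^ 2 ∂P := by
        refine setLIntegral_mono' (measurableSet_exitTime_eq hX s k) fun ω hω => ?_
        have h1 := ((exitTime_eq_iff X s ω k).1 hω).1
        rw [ENNReal.ofReal_pow hs, ← ofReal_norm]
        gcongr
    -- The increment after time `k` is centered and independent of the first `k` steps, which
    -- determine both `S_k` and the event.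
    _ ≤ ∫⁻ ω in {ω | exitTime X s ω = k}, ‖partialSum X (k + m) ω‖ₑ ^ 2 ∂P := by
        have := setLIntegral_enorm_sq_le_add P (measurable_firstSteps hX k)
          (measurable_partialSum (fun i => hX (k + i)) m)
          (indepFun_firstSteps_partialSum hX hind k m)
          (integrable_partialSum (fun i => hi (k + i)) m)
          (integral_partialSum_eq_zero (fun i => hi (k + i)) (fun i => h0 (k + i)) m)
          (A := {w | exitTime (stoppedSteps k) s w = k})
          (measurableSet_exitTime_eq (measurable_stoppedSteps k) _ _)
          (f := partialSum (stoppedSteps k) k) (by fun_prop)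
        rw [← setOf_exitTime_eq] at this
        simp only [partialSum_stoppedSteps X le_rfl] at this
        simpa only [← partialSum_add X k m] using this

lemma lintegral_enorm_sq_partialSum_mono {P : Measure Ω} [IsProbabilityMeasure P]
    {X : ℕ → Ω → B} (hX : ∀ i, Measurable (X i)) (hind : iIndepFun X P)
    (hi : ∀ i, Integrable (X i) P) (h0 : ∀ i, ∫ ω, X i ω ∂P = 0) {m n : ℕ} (hmn : m ≤ n) :
    ∫⁻ ω, ‖partialSum X m ω‖ₑ ^ 2 ∂P ≤ ∫⁻ ω, ‖partialSum X n ω‖ₑ ^ 2 ∂P := by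
  obtain ⟨k, rfl⟩ := Nat.exists_eq_add_of_le hmn
  have h := setLIntegral_enorm_sq_le_add P (measurable_firstSteps hX m)
      (measurable_partialSum (fun i => hX (m + i)) k)
      (indepFun_firstSteps_partialSum hX hind m k)
      (integrable_partialSum (fun i => hi (m + i)) k)
      (integral_partialSum_eq_zero (fun i => hi (m + i)) (fun i => h0 (m + i)) k)
      MeasurableSet.univ (f := partialSum (stoppedSteps m) m) (by fun_prop)
  simp only [partialSum_stoppedSteps X le_rfl, Set.preimage_univ, Measure.restrict_univ] at h
  simpa only [← partialSum_add X m k] using h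

/-- The walk restarts at the exit time. -/
lemma setLIntegral_exitTime_eq_partialSum_shift {P : Measure Ω} {X : ℕ → Ω → B}
    (hX : ∀ i, Measurable (X i)) (hind : iIndepFun X P)
    (hid : ∀ i, IdentDistrib (X i) (X 0) P P) (r : ℝ) (k m : ℕ) :
    ∫⁻ ω in {ω | exitTime X r ω = k}, ‖partialSum (fun i => X (k + i)) m ω‖ₑ ^ 2 ∂P =
      P {ω | exitTime X r ω = k} * ∫⁻ ω, ‖partialSum X m ω‖ₑ ^ 2 ∂P := by
  have hsm := measurableSet_exitTime_eq hX r k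
  set A : Set (Fin k → B) := {w | exitTime (stoppedSteps k) r w = k} with hA
  have hAm : MeasurableSet A := measurableSet_exitTime_eq (measurable_stoppedSteps k) _ _
  have hm1 : Measurable (A.indicator (1 : (Fin k → B) → ENNReal)) := measurable_one.indicator hAm
  have hm2 : Measurable fun b : B => ‖b‖ₑ ^ 2 := by fun_prop
  have h := lintegral_mul_eq_lintegral_mul_lintegral_of_indepFun
    (hm1.comp (measurable_firstSteps hX k))
    (hm2.comp (measurable_partialSum (fun i => hX (k + i)) m))
    ((indepFun_firstSteps_partialSum hX hind k m).comp hm1 hm2)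
  have hl := ((identDistrib_partialSum_shift hind hid k m).comp hm2).lintegral_eq
  have hone : A.indicator (1 : (Fin k → B) → ENNReal) ∘ firstSteps X k =
      {ω | exitTime X r ω = k}.indicator 1 := by
    rw [setOf_exitTime_eq]
    rfl
  rw [hl, hone, lintegral_indicator_one hsm] at h
  simp only [Function.comp_apply] at h
  rw [← h, ← lintegral_indicator hsm]
  congr 1 with ω
  by_cases hω : ω ∈ {ω | exitTime X r ω = k} <;> simp [hω]

/-- A Hoffmann-Jørgensen type inequality: the part of `‖S_m‖` above `r + M` is controlled by
the probability that the walk leaves the ball of radius `r`. -/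
lemma lintegral_norm_partialSum_sub_le {P : Measure Ω} [IsProbabilityMeasure P] {X : ℕ → Ω → B}
    (hX : ∀ i, Measurable (X i)) (hind : iIndepFun X P)
    (hid : ∀ i, IdentDistrib (X i) (X 0) P P) (hi : ∀ i, Integrable (X i) P)
    (h0 : ∀ i, ∫ ω, X i ω ∂P = 0) {r M : ℝ} (hr : 0 ≤ r) (hM : ∀ i ω, ‖X i ω‖ ≤ M) (n : ℕ) :
    ∫⁻ ω, ENNReal.ofReal (‖partialSum X n ω‖ - (r + M)) ^ 2 ∂P ≤
      P {ω | exitTime X r ω ≤ n} * ∫⁻ ω, ‖partialSum X n ω‖ₑ ^ 2 ∂P := by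
  set f : Ω → ENNReal := fun ω => ENNReal.ofReal (‖partialSum X n ω‖ - (r + M)) ^ 2 with hf
  -- Without an exit up to time `n`, `‖S_n‖ ≤ r` and the integrand vanishes.
  have hsupp : {ω | exitTime X r ω ≤ n}.indicator f = f := by
    ext ω
    by_cases h : exitTime X r ω ≤ n
    · rw [Set.indicator_of_mem (by exact h)]
    · rw [Set.indicator_of_notMem (by exact h)]
      have := (lt_exitTime_iff X r ω n).1 (not_le.1 h) n le_rfl
      have hM0 := (norm_nonneg _).trans (hM 0 ω)
      simp only [hf]
      rw [ENNReal.ofReal_of_nonpos (by linarith)]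
      simp
  rw [← hsupp, lintegral_indicator (measurableSet_exitTime_le hX r n),
    setLIntegral_exitTime_le hX, ← setLIntegral_one {ω | exitTime X r ω ≤ n},
    setLIntegral_exitTime_le hX, Finset.sum_mul]
  refine Finset.sum_le_sum fun k hk => ?_
  have hk' : k ≤ n := by simpa [Nat.lt_succ_iff] using hk
  obtain ⟨m, rfl⟩ := Nat.exists_eq_add_of_le hk'
  rw [setLIntegral_one]
  calc ∫⁻ ω in {ω | exitTime X r ω = k}, f ω ∂P
      ≤ ∫⁻ ω in {ω | exitTime X r ω = k}, ‖partialSum (fun i => X (k + i)) m ω‖ₑ ^ 2 ∂P := by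
        refine setLIntegral_mono' (measurableSet_exitTime_eq hX r k) fun ω hω => ?_
        obtain ⟨h1, h2⟩ := (exitTime_eq_iff X r ω k).1 hω
        simp only [hf]
        rw [← ofReal_norm]
        gcongr
        rw [partialSum_add]
        have h3 := norm_add_le (partialSum X k ω) (partialSum (fun i => X (k + i)) m ω)
        -- The overshoot at the exit is at most one step; exit at time `0` is impossible.
        have h4 : ‖partialSum X k ω‖ ≤ r + M := by
          rcases k with _ | k
          · rw [partialSum_zero, norm_zero] at h1
            exact absurd h1 (not_lt.2 hr)
          · rw [partialSum_succ]
            exact (norm_add_le _ _).trans (add_le_add (h2 k k.lt_succ_self) (hM k ω))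
        linarith
    _ = P {ω | exitTime X r ω = k} * ∫⁻ ω, ‖partialSum X m ω‖ₑ ^ 2 ∂P :=
        setLIntegral_exitTime_eq_partialSum_shift hX hind hid r k m
    _ ≤ _ := by
        refine mul_le_mul_right ?_ _
        exact lintegral_enorm_sq_partialSum_mono hX hind hi h0 (by omega)

/-- If a walk with steps bounded by `M` probably stays in the ball of radius `r` up to time `n`,
then `E‖S_n‖² ≤ 3 (r + M)²`. -/
lemma lintegral_enorm_sq_partialSum_le {P : Measure Ω} [IsProbabilityMeasure P] {X : ℕ → Ω → B}
    (hX : ∀ i, Measurable (X i)) (hind : iIndepFun X P)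
    (hid : ∀ i, IdentDistrib (X i) (X 0) P P) (hi : ∀ i, Integrable (X i) P)
    (h0 : ∀ i, ∫ ω, X i ω ∂P = 0) {r M : ℝ} (hr : 0 ≤ r) (hM : ∀ i ω, ‖X i ω‖ ≤ M) (n : ℕ)
    (hexit : exitProb P X r n ≤ 1 / 8) :
    ∫⁻ ω, ‖partialSum X n ω‖ₑ ^ 2 ∂P ≤ ENNReal.ofReal (3 * (r + M) ^ 2) := by
  set F := ∫⁻ ω, ‖partialSum X n ω‖ₑ ^ 2 ∂P with hF
  obtain ⟨ω₀⟩ : Nonempty Ω := nonempty_of_isProbabilityMeasure P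
  have hM0 : 0 ≤ M := (norm_nonneg _).trans (hM 0 ω₀)
  -- Finiteness is needed to absorb a multiple of `F` into the left side below.
  have hFtop : F ≠ ⊤ := by
    have hb : ∀ ω, ‖partialSum X n ω‖ₑ ^ 2 ≤ ENNReal.ofReal ((n * M) ^ 2) := fun ω => by
      rw [← ofReal_norm, ENNReal.ofReal_pow (by positivity)]
      gcongr
      refine (norm_sum_le _ _).trans ?_
      simpa using Finset.sum_le_card_nsmul (Finset.range n) _ M fun i _ => hM i ω
    refine ((lintegral_mono hb).trans_lt ?_).ne
    simp
  -- With `ρ = r + M`: `t² ≤ 2 (t - ρ)₊² + 2 ρ²`.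
  have hpt : ∀ ω, ‖partialSum X n ω‖ₑ ^ 2 ≤
      2 * ENNReal.ofReal (‖partialSum X n ω‖ - (r + M)) ^ 2 +
        ENNReal.ofReal (2 * (r + M) ^ 2) := fun ω => by
    rw [← ofReal_norm]
    set t := ‖partialSum X n ω‖ with ht
    have ht0 : 0 ≤ t := norm_nonneg _
    rcases le_total t (r + M) with h | h
    · refine le_add_left ?_
      rw [← ENNReal.ofReal_pow ht0]
      apply ENNReal.ofReal_le_ofReal
      nlinarith
    · rw [← ENNReal.ofReal_pow ht0, ← ENNReal.ofReal_pow (by linarith),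
        ← ENNReal.ofReal_ofNat 2, ← ENNReal.ofReal_mul (by norm_num),
        ← ENNReal.ofReal_add (by positivity) (by positivity)]
      apply ENNReal.ofReal_le_ofReal
      nlinarith [sq_nonneg (t - 2 * (r + M))]
  have h8 : P {ω | exitTime X r ω ≤ n} ≤ ENNReal.ofReal (1 / 8) := by
    rw [← ofReal_measureReal]
    exact ENNReal.ofReal_le_ofReal hexit
  -- That is `F ≤ F / 4 + 2 ρ²`, so `F ≤ (8 / 3) ρ² ≤ 3 ρ²`.
  have h1 : F ≤ 2 * (ENNReal.ofReal (1 / 8) * F) + ENNReal.ofReal (2 * (r + M) ^ 2) := by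
    calc F ≤ ∫⁻ ω, (2 * ENNReal.ofReal (‖partialSum X n ω‖ - (r + M)) ^ 2 +
          ENNReal.ofReal (2 * (r + M) ^ 2)) ∂P := lintegral_mono hpt
      _ = 2 * ∫⁻ ω, ENNReal.ofReal (‖partialSum X n ω‖ - (r + M)) ^ 2 ∂P +
          ENNReal.ofReal (2 * (r + M) ^ 2) := by
        have := measurable_partialSum hX n
        rw [lintegral_add_right _ measurable_const, lintegral_const_mul _ (by fun_prop)]
        simp
      _ ≤ _ := by
        gcongr
        exact (lintegral_norm_partialSum_sub_le hX hind hid hi h0 hr hM n).trans (by gcongr)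
  lift F to NNReal using hFtop with G
  have h2 : (G : ENNReal) = ENNReal.ofReal G := by simp
  rw [h2] at h1 ⊢
  rw [← ENNReal.ofReal_mul (by norm_num), ← ENNReal.ofReal_ofNat 2,
    ← ENNReal.ofReal_mul (by norm_num), ← ENNReal.ofReal_add (by positivity) (by positivity),
    ENNReal.ofReal_le_ofReal_iff (by positivity)] at h1
  apply ENNReal.ofReal_le_ofReal
  nlinarith [sq_nonneg (r + M)]

end Maximal

/-! ### From type 2 to the bound on exit probabilities, by truncation. -/

section TypeTwo

variable {B : Type u} [NormedAddCommGroup B] [NormedSpace ℝ B] [CompleteSpace B] [MeasurableSpace B]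
  [BorelSpace B] [SecondCountableTopology B] {Ω : Type u} [MeasurableSpace Ω]

lemma lintegral_enorm_sq_eq_ofReal {P : Measure Ω} {f : Ω → B} (hf : MemLp f 2 P) :
    ∫⁻ ω, ‖f ω‖ₑ ^ 2 ∂P = ENNReal.ofReal (∫ ω, ‖f ω‖ ^ 2 ∂P) := by
  rw [ofReal_integral_eq_lintegral_ofReal hf.norm.integrable_sq (ae_of_all _ fun _ => by positivity)]
  congr 1 with ω
  rw [ENNReal.ofReal_pow (norm_nonneg _), ofReal_norm]

/-- The identity on the closed ball of radius `r`, and zero outside of it. -/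
def truncate (r : ℝ) : B → B := {b | ‖b‖ ≤ r}.indicator id

lemma measurable_truncate (r : ℝ) : Measurable (truncate (B := B) r) :=
  measurable_id.indicator (measurableSet_le measurable_norm measurable_const)

lemma norm_truncate_le {r : ℝ} (hr : 0 ≤ r) (b : B) : ‖truncate r b‖ ≤ r := by
  by_cases h : b ∈ {b : B | ‖b‖ ≤ r}
  · rw [truncate, Set.indicator_of_mem h]
    exact h
  · simpa [truncate, h] using hr

lemma truncate_of_norm_le {r : ℝ} {b : B} (h : ‖b‖ ≤ r) : truncate r b = b :=
  Set.indicator_of_mem (s := {b : B | ‖b‖ ≤ r}) h _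

lemma integral_truncate (P : Measure Ω) {Y : Ω → B} (hY : Measurable Y) (r : ℝ) :
    ∫ ω, truncate r (Y ω) ∂P = ∫ ω in {ω | ‖Y ω‖ ≤ r}, Y ω ∂P := by
  rw [← integral_indicator (measurableSet_norm_le hY r)]
  rfl

lemma integral_norm_sq_truncate (P : Measure Ω) {Y : Ω → B} (hY : Measurable Y) (r : ℝ) :
    ∫ ω, ‖truncate r (Y ω)‖ ^ 2 ∂P = ∫ ω in {ω | ‖Y ω‖ ≤ r}, ‖Y ω‖ ^ 2 ∂P := by
  rw [← integral_indicator (measurableSet_norm_le hY r)]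
  congr 1 with ω
  by_cases h : ‖Y ω‖ ≤ r <;> simp [truncate, h]

lemma memLp_of_norm_le {P : Measure Ω} [IsFiniteMeasure P] {Y : Ω → B} (hY : Measurable Y) {M : ℝ}
    (hM : ∀ ω, ‖Y ω‖ ≤ M) : MemLp Y 2 P :=
  MemLp.of_bound hY.aestronglyMeasurable M (ae_of_all _ hM)

/-- Without an inner product, centering may increase the second moment; the triangle inequality and
Jensen for the mean give the factor `4`. -/
lemma integral_norm_sub_integral_sq_le (P : Measure Ω) [IsProbabilityMeasure P] {Y : Ω → B}
    (h2 : MemLp Y 2 P) :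
    ∫ ω, ‖Y ω - ∫ ω, Y ω ∂P‖ ^ 2 ∂P ≤ 4 * ∫ ω, ‖Y ω‖ ^ 2 ∂P := by
  set e := ∫ ω, Y ω ∂P with he
  have hi2 : Integrable (fun ω => ‖Y ω‖ ^ 2) P := h2.norm.integrable_sq
  have h1 : ‖e‖ ^ 2 ≤ ∫ ω, ‖Y ω‖ ^ 2 ∂P := by
    have : ‖e‖ₑ ^ 2 ≤ ENNReal.ofReal (∫ ω, ‖Y ω‖ ^ 2 ∂P) := by
      rw [← lintegral_enorm_sq_eq_ofReal h2]
      calc ‖e‖ₑ ^ 2 ≤ (∫⁻ ω, ‖Y ω‖ₑ ∂P) ^ 2 := by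
            gcongr; exact enorm_integral_le_lintegral_enorm _
        _ ≤ _ := lintegral_sq_le P h2.aestronglyMeasurable.enorm
    rwa [← ofReal_norm, ← ENNReal.ofReal_pow (norm_nonneg _),
      ENNReal.ofReal_le_ofReal_iff (integral_nonneg fun _ => by positivity)] at this
  have hpt : ∀ ω, ‖Y ω - e‖ ^ 2 ≤ 2 * ‖Y ω‖ ^ 2 + 2 * ‖e‖ ^ 2 := fun ω => by
    have := norm_sub_le (Y ω) e
    nlinarith [sq_nonneg (‖Y ω‖ - ‖e‖), norm_nonneg (Y ω - e), norm_nonneg (Y ω), norm_nonneg e]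
  have hint : Integrable (fun ω => 2 * ‖Y ω‖ ^ 2 + 2 * ‖e‖ ^ 2) P :=
    (hi2.const_mul 2).add (integrable_const _)
  calc ∫ ω, ‖Y ω - e‖ ^ 2 ∂P ≤ ∫ ω, (2 * ‖Y ω‖ ^ 2 + 2 * ‖e‖ ^ 2) ∂P :=
        integral_mono (h2.sub (memLp_const e)).norm.integrable_sq hint hpt
    _ = 2 * ∫ ω, ‖Y ω‖ ^ 2 ∂P + 2 * ‖e‖ ^ 2 := by
        rw [integral_add (hi2.const_mul 2) (integrable_const _), integral_const_mul]
        simp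
    _ ≤ _ := by linarith

/-- The exit probability of the centered walk, under type 2. -/
lemma TypeTwoWith.exitProb_le {c : ℝ} (h : TypeTwoWith B c) (P : Measure Ω)
    [IsProbabilityMeasure P] {Z : ℕ → Ω → B} (hZ : ∀ i, Measurable (Z i)) (hind : iIndepFun Z P)
    (hid : ∀ i, IdentDistrib (Z i) (Z 0) P P) (h2 : ∀ i, MemLp (Z i) 2 P)
    (h0 : ∀ i, ∫ ω, Z i ω ∂P = 0) {s : ℝ} (hs : 0 < s) (n : ℕ) :
    s ^ 2 * exitProb P Z s n ≤ c * (n * ∫ ω, ‖Z 0 ω‖ ^ 2 ∂P) := by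
  have h1 := sq_mul_measure_exitTime_le hZ hind (fun i => (h2 i).integrable one_le_two) h0 hs.le n
  have hmem : MemLp (partialSum Z n) 2 P := memLp_finsetSum _ fun i _ => h2 i
  rw [lintegral_enorm_sq_eq_ofReal hmem, ← ofReal_measureReal,
    ← ENNReal.ofReal_mul (by positivity),
    ENNReal.ofReal_le_ofReal_iff (integral_nonneg fun _ => by positivity)] at h1
  refine h1.trans ?_
  have h3 := h Ω P n (fun i => Z i) (fun i => hZ i)
    (hind.precomp Fin.val_injective) (fun i => h2 i) (fun i => h0 i)
  have h4 : ∀ i : ℕ, ∫ ω, ‖Z i ω‖ ^ 2 ∂P = ∫ ω, ‖Z 0 ω‖ ^ 2 ∂P := fun i =>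
    ((hid i).norm.sq).integral_eq
  simpa [partialSum, Finset.sum_range, h4] using h3

lemma TypeTwoWith.probabilityBound {c : ℝ} (hc : 0 < c) (h : TypeTwoWith B c) :
    ProbabilityBound B (3 + 16 * c) := by
  intro Ω _ P _ X hX r hr n hn
  have hn0 : (0 : ℝ) < n := by exact_mod_cast hn
  have hG := tailFn_nonneg P (X 0) r
  have hK := truncSecondMoment_nonneg P (X 0) r
  have hM := norm_nonneg (truncMean P (X 0) r)
  -- If `n ‖M(r)‖ > 1 / 2`, the right side exceeds `1`. Otherwise the drift of the truncated walk up
  -- to time `n` is at most `r / 2`.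
  rcases lt_or_ge (1 / 2) (n * ‖truncMean P (X 0) r‖) with hbig | hsmall
  · have h1 : exitProb P X r n ≤ 1 := measureReal_le_one
    unfold pruittFn
    nlinarith [mul_nonneg hn0.le hG, mul_nonneg hn0.le hK, mul_nonneg hn0.le hM,
      mul_nonneg hc.le (mul_nonneg hn0.le hG), mul_nonneg hc.le (mul_nonneg hn0.le hK),
      mul_nonneg hc.le (mul_nonneg hn0.le hM)]
  set Y : ℕ → Ω → B := fun i ω => truncate r (X i ω) with hY
  have hYm : ∀ i, Measurable (Y i) := fun i => (measurable_truncate r).comp (hX.measurable i)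
  have hYid : ∀ i, IdentDistrib (Y i) (Y 0) P P := fun i =>
    (hX.identDistrib i).comp (measurable_truncate r)
  have hYb : ∀ i ω, ‖Y i ω‖ ≤ r := fun i ω => norm_truncate_le hr.le _
  set e := ∫ ω, Y 0 ω ∂P with he
  set Z : ℕ → Ω → B := fun i ω => Y i ω - e with hZ
  have hgm : Measurable fun b : B => truncate r b - e := (measurable_truncate r).sub_const e
  have hZm : ∀ i, Measurable (Z i) := fun i => (hYm i).sub_const e
  have hZind : iIndepFun Z P := hX.indep.comp (fun _ b => truncate r b - e) fun _ => hgm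
  have hZid : ∀ i, IdentDistrib (Z i) (Z 0) P P := fun i => (hX.identDistrib i).comp hgm
  have hY2 : ∀ i, MemLp (Y i) 2 P := fun i => memLp_of_norm_le (hYm i) (hYb i)
  have hZ2 : ∀ i, MemLp (Z i) 2 P := fun i => (hY2 i).sub (memLp_const e)
  have hZ0 : ∀ i, ∫ ω, Z i ω ∂P = 0 := fun i => by
    simp only [hZ]
    rw [integral_sub ((hY2 i).integrable one_le_two) (integrable_const _), (hYid i).integral_eq]
    simp [he]
  have hexit := h.exitProb_le P hZm hZind hZid hZ2 hZ0 (half_pos hr) n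
  have hvar : ∫ ω, ‖Z 0 ω‖ ^ 2 ∂P ≤ 4 * (r ^ 2 * truncSecondMoment P (X 0) r) := by
    refine (integral_norm_sub_integral_sq_le P (hY2 0)).trans_eq ?_
    rw [integral_norm_sq_truncate P (hX.measurable 0)]
    unfold truncSecondMoment
    field_simp
  -- The constant `16` is `4` from centering times `4` from halving the radius.
  have hexit' : exitProb P Z (r / 2) n ≤ 16 * c * n * truncSecondMoment P (X 0) r := by
    have h1 : (r / 2) ^ 2 * exitProb P Z (r / 2) n ≤
        c * (n * (4 * (r ^ 2 * truncSecondMoment P (X 0) r))) :=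
      hexit.trans (by gcongr)
    have h2 : (r / 2) ^ 2 * exitProb P Z (r / 2) n ≤
        (r / 2) ^ 2 * (16 * c * n * truncSecondMoment P (X 0) r) := h1.trans_eq (by ring)
    exact le_of_mul_le_mul_left h2 (by positivity)
  have he' : ‖e‖ = r * ‖truncMean P (X 0) r‖ := by
    unfold truncMean
    rw [he, integral_truncate P (hX.measurable 0), norm_smul, Real.norm_of_nonneg (by positivity)]
    field_simp
  -- If no step exceeds `r`, then `S_j` is the centered truncated sum plus `j e`, with `‖j e‖ ≤ r /
  -- 2`.
  have hsub : {ω | exitTime X r ω ≤ n} ⊆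
      (⋃ i ∈ Finset.range n, {ω | r < ‖X i ω‖}) ∪ {ω | exitTime Z (r / 2) ω ≤ n} := by
    intro ω hω
    by_cases hall : ∀ i < n, ‖X i ω‖ ≤ r
    · right
      obtain ⟨j, hj, hlt⟩ := (exitTime_le_iff X r ω n).1 hω
      refine (exitTime_le_iff Z _ ω n).2 ⟨j, hj, ?_⟩
      have hS : partialSum X j ω = partialSum Z j ω + (j : ℝ) • e := by
        have : partialSum X j ω = ∑ i ∈ Finset.range j, (Z i ω + e) := by
          refine Finset.sum_congr rfl fun i hi => ?_
          simp [hZ, hY, truncate_of_norm_le (hall i ((Finset.mem_range.1 hi).trans_le hj))]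
        rw [this, Finset.sum_add_distrib, Finset.sum_const, Finset.card_range, partialSum,
          Nat.cast_smul_eq_nsmul]
      have h1 := norm_add_le (partialSum Z j ω) ((j : ℝ) • e)
      rw [← hS, norm_smul, Real.norm_natCast, he'] at h1
      have h2 : (j : ℝ) * (r * ‖truncMean P (X 0) r‖) ≤ r / 2 :=
        calc (j : ℝ) * (r * ‖truncMean P (X 0) r‖) ≤ n * (r * ‖truncMean P (X 0) r‖) := by gcongr
          _ = r * (n * ‖truncMean P (X 0) r‖) := by ring
          _ ≤ r * (1 / 2) := by gcongr
          _ = r / 2 := by ring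
      linarith
    · left
      push Not at hall
      obtain ⟨i, hi, hlt⟩ := hall
      simp only [Set.mem_iUnion, Finset.mem_range, exists_prop]
      exact ⟨i, hi, hlt⟩
  have htail : ∀ i, P.real {ω | r < ‖X i ω‖} = tailFn P (X 0) r := fun i => by
    have := (hX.identDistrib i).measure_mem_eq (s := {b | r < ‖b‖})
      (measurableSet_lt measurable_const measurable_norm)
    exact congrArg ENNReal.toReal this
  calc exitProb P X r n
      ≤ ∑ i ∈ Finset.range n, P.real {ω | r < ‖X i ω‖} + exitProb P Z (r / 2) n :=
        (measureReal_mono hsub).trans ((measureReal_union_le _ _).trans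
          (add_le_add_left (measureReal_biUnion_finset_le _ _) _))
    _ ≤ n * tailFn P (X 0) r + 16 * c * n * truncSecondMoment P (X 0) r := by
        simp only [htail, Finset.sum_const, Finset.card_range, nsmul_eq_mul]
        gcongr
    _ ≤ _ := by
        unfold pruittFn
        nlinarith [mul_nonneg hn0.le hG, mul_nonneg hn0.le hK, mul_nonneg hn0.le hM,
          mul_nonneg hc.le (mul_nonneg hn0.le hG), mul_nonneg hc.le (mul_nonneg hn0.le hK),
          mul_nonneg hc.le (mul_nonneg hn0.le hM)]

end TypeTwo

/-! ### From mean exit times to second moments, for bounded steps. -/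

section SecondMoment

variable {B : Type u} [NormedAddCommGroup B] [NormedSpace ℝ B] [CompleteSpace B] [MeasurableSpace B]
  [BorelSpace B] [SecondCountableTopology B] {Ω : Type u} [MeasurableSpace Ω]

/-- Under condition (iv) the second moments of a centered walk with bounded steps grow at most
linearly, with a constant that depends only on `c`. -/
lemma AsymptoticExpectationBound.lintegral_enorm_sq_le {c : ℝ} (hc : 0 < c)
    (h : AsymptoticExpectationBound B c) (P : Measure Ω) [IsProbabilityMeasure P]
    {X : ℕ → Ω → B} (hX : IsCenteredStepSequence P X) {M : ℝ} (hM : ∀ i ω, ‖X i ω‖ ≤ M) :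
    ∀ᶠ m : ℕ in atTop, ∫⁻ ω, ‖partialSum X m ω‖ₑ ^ 2 ∂P ≤
      ENNReal.ofReal (432 * m * (∫ ω, ‖X 0 ω‖ ^ 2 ∂P) / c) := by
  have hσ := integral_norm_sq_pos P hX.memLp hX.nondegenerate
  set σ := ∫ ω, ‖X 0 ω‖ ^ 2 ∂P
  have hi : ∀ i, Integrable (X i) P := fun i =>
    (hX.identDistrib i).integrable_iff.2 (hX.memLp.integrable one_le_two)
  have h0 : ∀ i, ∫ ω, X i ω ∂P = 0 := fun i =>
    (hX.identDistrib i).integral_eq.trans hX.mean_zero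
  -- Half of the constant is given up for a strict inequality, which then holds for all large radii.
  have hlt : ENNReal.ofReal (c / (2 * σ)) <
      liminf (fun r : ℝ => expectedExitTime P X r / ENNReal.ofReal (r ^ 2)) atTop :=
    ((ENNReal.ofReal_lt_ofReal_iff (by positivity)).2
      (div_lt_div_of_pos_left hc hσ (by linarith))).trans_le (h Ω P X hX)
  have hev := eventually_lt_of_lt_liminf hlt
  have htend : Tendsto (fun m : ℕ => √(16 * m * σ / c)) atTop atTop := by
    refine Real.tendsto_sqrt_atTop.comp ?_
    have : Tendsto (fun m : ℕ => 16 * σ / c * (m : ℝ)) atTop atTop :=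
      tendsto_natCast_atTop_atTop.const_mul_atTop (by positivity)
    refine this.congr fun m => ?_
    ring
  filter_upwards [htend.eventually hev, htend.eventually_ge_atTop (2 * M),
    htend.eventually_gt_atTop 0, eventually_gt_atTop 0] with m h1 h2 h3 hm
  have hm0 : (0 : ℝ) < m := by exact_mod_cast hm
  -- Chosen so that `c r² / (2 σ) = 8 m`; then `E T_r ≥ 8 m` forces `P(T_{2r} ≤ m) ≤ 1 / 8`.
  set r := √(16 * m * σ / c) with hr
  have hr2 : r ^ 2 = 16 * m * σ / c := Real.sq_sqrt (by positivity)
  have hE : ENNReal.ofReal (8 * m) ≤ expectedExitTime P X r := by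
    have h4 := h1.le
    rw [ENNReal.le_div_iff_mul_le (by simp [h3.ne']) (by simp),
      ← ENNReal.ofReal_mul (by positivity), hr2] at h4
    refine le_trans (ENNReal.ofReal_le_ofReal (le_of_eq ?_)) h4
    field_simp
    norm_num
  have hexit : exitProb P X (2 * r) m ≤ 1 / 8 := by
    have h5 : ENNReal.ofReal (8 * m) * P {ω | exitTime X (2 * r) ω ≤ m} ≤ m :=
      (mul_le_mul_left hE _).trans
        (expectedExitTime_mul_measure_le hX.measurable hX.indep hX.identDistrib r hm)
    rw [← ofReal_measureReal, ← ENNReal.ofReal_mul (by positivity), ← ENNReal.ofReal_natCast,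
      ENNReal.ofReal_le_ofReal_iff (by positivity)] at h5
    unfold exitProb
    have h6 : (m : ℝ) * (8 * P.real {ω | exitTime X (2 * r) ω ≤ m}) ≤ m * 1 := by linarith
    linarith [le_of_mul_le_mul_left h6 hm0]
  obtain ⟨ω₀⟩ : Nonempty Ω := nonempty_of_isProbabilityMeasure P
  have hM0 : 0 ≤ M := (norm_nonneg _).trans (hM 0 ω₀)
  refine (lintegral_enorm_sq_partialSum_le hX.measurable hX.indep hX.identDistrib hi h0
    (by positivity) hM m hexit).trans (ENNReal.ofReal_le_ofReal ?_)
  -- For large `m` one has `M ≤ r`, so `3 (2 r + M)² ≤ 27 r²`, and `27 · 16 = 432`.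
  have : 432 * m * σ / c = 27 * r ^ 2 := by rw [hr2]; ring
  rw [this]
  nlinarith

end SecondMoment

/-! ### A lower bound for first absolute moments of real random walks. -/

section RealMoments

variable {Ω : Type u} [MeasurableSpace Ω]

/-- With `t = √q`, integrate the pointwise bound `y ≥ y² / (2 t) - y⁴ / (32 t³)` for `y = |R|`; the
moments give at least `t / 2 - t / 8`. -/
lemma integral_abs_ge_of_moments {P : Measure Ω} [IsProbabilityMeasure P] {R : Ω → ℝ}
    (hR : Measurable R) {M : ℝ} (hM : ∀ ω, |R ω| ≤ M) {q : ℝ} (hq : 0 < q)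
    (h2 : ∫ ω, R ω ^ 2 ∂P = q) (h4 : ∫ ω, R ω ^ 4 ∂P ≤ 4 * q ^ 2) :
    3 / 8 * √q ≤ ∫ ω, |R ω| ∂P := by
  have hint : ∀ k : ℕ, Integrable (fun ω => R ω ^ k) P := fun k =>
    Integrable.of_bound (hR.pow_const k).aestronglyMeasurable (M ^ k)
      (ae_of_all _ fun ω => by
        rw [norm_pow, Real.norm_eq_abs]
        gcongr
        exact hM ω)
  set t := √q with ht
  have ht0 : 0 < t := Real.sqrt_pos.2 hq
  have htq : t ^ 2 = q := Real.sq_sqrt hq.le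
  have hpt : ∀ ω, R ω ^ 2 * (1 / (2 * t)) - R ω ^ 4 * (1 / (32 * t ^ 3)) ≤ |R ω| := fun ω => by
    have e2 : R ω ^ 2 = |R ω| ^ 2 := (sq_abs _).symm
    have e4 : R ω ^ 4 = |R ω| ^ 4 := by rw [show 4 = 2 * 2 from rfl, pow_mul, pow_mul, sq_abs]
    rw [e2, e4]
    set y := |R ω|
    have hy : 0 ≤ y := abs_nonneg _
    have key : 0 ≤ 32 * t ^ 3 - 16 * t ^ 2 * y + y ^ 3 := by
      nlinarith [mul_nonneg hy (sq_nonneg (y - 2 * t)), sq_nonneg (y - 2 * t),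
        mul_nonneg ht0.le (sq_nonneg (y - 2 * t)), mul_nonneg ht0.le (sq_nonneg t),
        mul_nonneg hy (sq_nonneg t), mul_nonneg ht0.le (sq_nonneg (y - t)),
        mul_nonneg ht0.le (sq_nonneg (3 * y - 5 * t)), mul_nonneg hy (sq_nonneg (y - 5 / 2 * t)),
        mul_nonneg ht0.le (sq_nonneg (2 * y - 5 * t))]
    have : y - (y ^ 2 * (1 / (2 * t)) - y ^ 4 * (1 / (32 * t ^ 3))) =
        y * (32 * t ^ 3 - 16 * t ^ 2 * y + y ^ 3) / (32 * t ^ 3) := by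
      field_simp
      ring
    have h3 : 0 ≤ y * (32 * t ^ 3 - 16 * t ^ 2 * y + y ^ 3) / (32 * t ^ 3) := by positivity
    linarith
  have hi1 : Integrable (fun ω => |R ω|) P := by simpa using (hint 1).abs
  have h := integral_mono (((hint 2).mul_const (1 / (2 * t))).sub
    ((hint 4).mul_const (1 / (32 * t ^ 3)))) hi1 hpt
  simp only [Pi.sub_apply] at h
  rw [integral_sub ((hint 2).mul_const _) ((hint 4).mul_const _), integral_mul_const,
    integral_mul_const, h2] at h
  refine le_trans ?_ h
  have h5 : (∫ ω, R ω ^ 4 ∂P) * (1 / (32 * t ^ 3)) ≤ 4 * q ^ 2 * (1 / (32 * t ^ 3)) := by gcongr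
  have h6 : q * (1 / (2 * t)) - 4 * q ^ 2 * (1 / (32 * t ^ 3)) = 3 / 8 * t := by
    rw [← htq]
    field_simp
    norm_num
  linarith

/-- Second and fourth moments of a random walk with steps bounded by one. -/
lemma moments_sum_range {P : Measure Ω} [IsProbabilityMeasure P] {ξ : ℕ → Ω → ℝ}
    (hm : ∀ i, Measurable (ξ i)) (hind : iIndepFun ξ P) (hb : ∀ i ω, |ξ i ω| ≤ 1)
    (h1 : ∀ i, ∫ ω, ξ i ω ∂P = 0) {p : ℝ} (h2 : ∀ i, ∫ ω, ξ i ω ^ 2 ∂P = p) (m : ℕ) :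
    ∫ ω, (∑ i ∈ Finset.range m, ξ i ω) ∂P = 0 ∧
      ∫ ω, (∑ i ∈ Finset.range m, ξ i ω) ^ 2 ∂P = m * p ∧
      ∫ ω, (∑ i ∈ Finset.range m, ξ i ω) ^ 4 ∂P ≤ m * p + 3 * (m * p) ^ 2 := by
  set S : ℕ → Ω → ℝ := fun m ω => ∑ i ∈ Finset.range m, ξ i ω with hS
  have hS0 : ∀ ω, S 0 ω = 0 := fun ω => by simp [hS]
  have hSs : ∀ m ω, S (m + 1) ω = S m ω + ξ m ω := fun m ω => Finset.sum_range_succ _ _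
  change ∫ ω, S m ω ∂P = 0 ∧ ∫ ω, S m ω ^ 2 ∂P = m * p ∧
    ∫ ω, S m ω ^ 4 ∂P ≤ m * p + 3 * (m * p) ^ 2
  have hSb : ∀ m ω, |S m ω| ≤ m := fun m ω => by
    refine (Finset.abs_sum_le_sum_abs _ _).trans ?_
    simpa using Finset.sum_le_card_nsmul (Finset.range m) _ 1 fun i _ => hb i ω
  have hSm : ∀ m, Measurable (S m) := fun m => Finset.measurable_fun_sum _ fun i _ => hm i
  have hint : ∀ m a b, Integrable (fun ω => S m ω ^ a * ξ m ω ^ b) P := fun m a b =>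
    Integrable.of_bound
      (((hSm m).pow_const a).mul ((hm m).pow_const b)).aestronglyMeasurable ((m : ℝ) ^ a * 1 ^ b)
      (ae_of_all _ fun ω => by
        rw [norm_mul, norm_pow, norm_pow, Real.norm_eq_abs, Real.norm_eq_abs]
        gcongr
        · exact hSb m ω
        · exact hb m ω)
  have hprod : ∀ m a b, ∫ ω, S m ω ^ a * ξ m ω ^ b ∂P =
      (∫ ω, S m ω ^ a ∂P) * ∫ ω, ξ m ω ^ b ∂P := fun m a b => by
    have hi : IndepFun (S m) (ξ m) P := by
      have := hind.indepFun_finsetSum_of_notMem hm (s := Finset.range m) (i := m) (by simp)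
      convert this using 1
      ext ω
      simp [hS]
    exact (hi.comp (measurable_id.pow_const a)
      (measurable_id.pow_const b)).integral_fun_mul_eq_mul_integral
      ((hSm m).pow_const a).aestronglyMeasurable ((hm m).pow_const b).aestronglyMeasurable
  have h4 : ∀ i, ∫ ω, ξ i ω ^ 4 ∂P ≤ p := fun i => by
    rw [← h2 i]
    refine integral_mono ?_ ?_ fun ω => ?_
    · simpa using hint i 0 4
    · simpa using hint i 0 2
    · have := hb i ω
      have h3 : ξ i ω ^ 2 ≤ 1 := (sq_le_one_iff_abs_le_one _).2 this
      nlinarith [sq_nonneg (ξ i ω)]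
  have hp : 0 ≤ p := by rw [← h2 0]; exact integral_nonneg fun _ => by positivity
  induction m with
  | zero => simp [hS0]
  | succ m ih =>
    obtain ⟨i1, i2, i4⟩ := ih
    -- Every term is written as `S ^ a * ξ ^ b`, zero exponents included, so that `hint` and `hprod`
    -- apply uniformly. Terms with a first power of `S` or `ξ` drop out, the one with `S * ξ ^ 3`
    -- because `E S_m = 0`; this is why the mean is part of the induction.
    have e1 : ∀ ω, S (m + 1) ω =
        S m ω ^ 1 * ξ m ω ^ 0 + S m ω ^ 0 * ξ m ω ^ 1 := fun ω => by
      rw [hSs]; ring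
    have e2 : ∀ ω, S (m + 1) ω ^ 2 =
        S m ω ^ 2 * ξ m ω ^ 0 + 2 * (S m ω ^ 1 * ξ m ω ^ 1) +
          S m ω ^ 0 * ξ m ω ^ 2 := fun ω => by
      rw [hSs]; ring
    have e4 : ∀ ω, S (m + 1) ω ^ 4 =
        S m ω ^ 4 * ξ m ω ^ 0 + 4 * (S m ω ^ 3 * ξ m ω ^ 1) +
          6 * (S m ω ^ 2 * ξ m ω ^ 2) + 4 * (S m ω ^ 1 * ξ m ω ^ 3) +
          S m ω ^ 0 * ξ m ω ^ 4 := fun ω => by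
      rw [hSs]; ring
    simp_rw [e2, e4, e1]
    refine ⟨?_, ?_, ?_⟩
    · rw [integral_add (hint _ _ _) (hint _ _ _), hprod, hprod]
      simp [i1, h1]
    · rw [integral_add ((hint _ _ _).fun_add ((hint _ _ _).const_mul _)) (hint _ _ _),
        integral_add (hint _ _ _) ((hint _ _ _).const_mul _), integral_const_mul, hprod, hprod,
        hprod]
      simp [i1, h1, i2, h2]
      ring
    · rw [integral_add ((((hint _ _ _).fun_add ((hint _ _ _).const_mul _)).fun_add
          ((hint _ _ _).const_mul _)).fun_add ((hint _ _ _).const_mul _)) (hint _ _ _),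
        integral_add (((hint _ _ _).fun_add ((hint _ _ _).const_mul _)).fun_add
          ((hint _ _ _).const_mul _)) ((hint _ _ _).const_mul _),
        integral_add ((hint _ _ _).fun_add ((hint _ _ _).const_mul _)) ((hint _ _ _).const_mul _),
        integral_add (hint _ _ _) ((hint _ _ _).const_mul _), integral_const_mul,
        integral_const_mul, integral_const_mul, hprod, hprod, hprod, hprod, hprod]
      simp [i1, h1, i2, h2]
      have := h4 m
      nlinarith [sq_nonneg p]

end RealMoments

/-! ### Rademacher type 2 implies type 2. -/

section Symmetrization

variable {B : Type u} [NormedAddCommGroup B] [NormedSpace ℝ B]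

/-- `c` is a type 2 constant for Rademacher sums in `B`. -/
def RademacherTypeTwoWith (B : Type u) [NormedAddCommGroup B] [NormedSpace ℝ B] (c : ℝ) : Prop :=
  ∀ (n : ℕ) (x : Fin n → B), ∑ ε : Fin n → ℤˣ, ‖∑ i, ((ε i : ℤ) : ℝ) • x i‖ ^ 2 ≤
    Fintype.card (Fin n → ℤˣ) * (c * ∑ i, ‖x i‖ ^ 2)

lemma units_eq_one_or_neg_one (s : ℤˣ) : ((s : ℤ) : ℝ) = 1 ∨ ((s : ℤ) : ℝ) = -1 := by
  rcases Int.units_eq_one_or s with rfl | rfl <;> simp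

/-- Only the absolute values of the coefficients matter for a Rademacher average. -/
lemma sum_signs_abs {M : Type*} [AddCommMonoid M] (F : B → M) {n : ℕ} (x : Fin n → B)
    (t : Fin n → ℝ) : ∑ ε : Fin n → ℤˣ, F (∑ i, ((ε i : ℤ) : ℝ) • |t i| • x i) =
      ∑ ε : Fin n → ℤˣ, F (∑ i, ((ε i : ℤ) : ℝ) • t i • x i) := by
  -- Multiplication by the signs of `t` permutes the sign vectors.
  set δ : Fin n → ℤˣ := fun i => if 0 ≤ t i then 1 else -1 with hδ
  refine Fintype.sum_equiv (Equiv.mulLeft δ) _ _ fun ε => ?_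
  congr 1
  refine Finset.sum_congr rfl fun i _ => ?_
  simp only [smul_smul, Equiv.coe_mulLeft, Pi.mul_apply, hδ]
  congr 1
  split_ifs with h
  · simp [abs_of_nonneg h]
  · simp [abs_of_neg (not_le.1 h)]

variable [CompleteSpace B] [MeasurableSpace B] [BorelSpace B] [SecondCountableTopology B]
  {Ω : Type u} [MeasurableSpace Ω]

/-- Changing signs changes the second moment of a sum of independent centered vectors by a factor
of at most four. -/
lemma lintegral_enorm_sq_sum_le_signed {P : Measure Ω} [IsProbabilityMeasure P] {n : ℕ}
    {X : Fin n → Ω → B} (hX : ∀ i, Measurable (X i)) (hind : iIndepFun X P)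
    (hi : ∀ i, Integrable (X i) P) (h0 : ∀ i, ∫ ω, X i ω ∂P = 0) (ε : Fin n → ℤˣ) :
    ∫⁻ ω, ‖∑ i, X i ω‖ₑ ^ 2 ∂P ≤ 4 * ∫⁻ ω, ‖∑ i, ((ε i : ℤ) : ℝ) • X i ω‖ₑ ^ 2 ∂P := by
  classical
  -- The sums `a` and `b` over the positive and the negative signs are independent and centered. The
  -- two norms concern `a + b` and `a - b`, and by Jensen `E‖a‖²` and `E‖b‖²` are both at most `E‖a
  -- - b‖²`.
  set A : Finset (Fin n) := Finset.univ.filter fun i => ε i = 1 with hA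
  set a : Ω → B := fun ω => ∑ i ∈ A, X i ω with ha
  set b : Ω → B := fun ω => ∑ i ∈ Aᶜ, X i ω with hb
  have ham : Measurable a := Finset.measurable_fun_sum _ fun i _ => hX i
  have hbm : Measurable b := Finset.measurable_fun_sum _ fun i _ => hX i
  have hai : Integrable a P := integrable_finsetSum _ fun i _ => hi i
  have hbi : Integrable b P := integrable_finsetSum _ fun i _ => hi i
  have ha0 : ∫ ω, a ω ∂P = 0 := by
    simp only [ha]; rw [integral_finsetSum _ fun i _ => hi i]; simp [h0]
  have hb0 : ∫ ω, b ω ∂P = 0 := by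
    simp only [hb]; rw [integral_finsetSum _ fun i _ => hi i]; simp [h0]
  have hab : IndepFun a b P := by
    have h := hind.indepFun_finset A Aᶜ disjoint_compl_right hX
    have hφ : Measurable fun w : A → B => ∑ i : A, w i := by fun_prop
    have hψ : Measurable fun w : (Aᶜ : Finset (Fin n)) → B => ∑ i, w i := by fun_prop
    have h' := h.comp hφ hψ
    convert h' using 1
    · ext ω
      exact (Finset.sum_coe_sort A fun i => X i ω).symm
    · ext ω
      exact (Finset.sum_coe_sort Aᶜ fun i => X i ω).symm
  have hsum : ∀ ω, ∑ i, X i ω = a ω + b ω := fun ω => (Finset.sum_add_sum_compl A _).symm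
  have hdiff : ∀ ω, ∑ i, ((ε i : ℤ) : ℝ) • X i ω = a ω - b ω := fun ω => by
    rw [← Finset.sum_add_sum_compl A, sub_eq_add_neg, ha, hb]
    simp only
    rw [← Finset.sum_neg_distrib]
    congr 1
    · refine Finset.sum_congr rfl fun i hi => ?_
      have : ε i = 1 := by simpa [hA] using hi
      simp [this]
    · refine Finset.sum_congr rfl fun i hi => ?_
      have : ε i = -1 := (Int.units_eq_one_or _).resolve_left (by simpa [hA] using hi)
      simp [this]
  simp only [hsum, hdiff]
  have h1 : ∫⁻ ω, ‖a ω‖ₑ ^ 2 ∂P ≤ ∫⁻ ω, ‖a ω - b ω‖ₑ ^ 2 ∂P := by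
    simpa [sub_eq_add_neg] using lintegral_enorm_sq_le_add P ham hbm.neg
      (hab.comp measurable_id measurable_neg) hbi.neg (by simp [integral_neg, hb0])
  have h2 : ∫⁻ ω, ‖b ω‖ₑ ^ 2 ∂P ≤ ∫⁻ ω, ‖a ω - b ω‖ₑ ^ 2 ∂P := by
    have := lintegral_enorm_sq_le_add P hbm ham.neg
      (hab.symm.comp measurable_id measurable_neg) hai.neg (by simp [integral_neg, ha0])
    simpa only [Pi.neg_apply, ← sub_eq_add_neg, ← enorm_neg (b _ - a _), neg_sub] using this
  have hpt : ∀ ω, ‖a ω + b ω‖ₑ ^ 2 ≤ 2 * ‖a ω‖ₑ ^ 2 + 2 * ‖b ω‖ₑ ^ 2 := fun ω => by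
    simp only [← ofReal_norm]
    rw [← ENNReal.ofReal_pow (norm_nonneg _), ← ENNReal.ofReal_pow (norm_nonneg _),
      ← ENNReal.ofReal_pow (norm_nonneg _), ← ENNReal.ofReal_ofNat 2,
      ← ENNReal.ofReal_mul (by norm_num), ← ENNReal.ofReal_mul (by norm_num),
      ← ENNReal.ofReal_add (by positivity) (by positivity)]
    apply ENNReal.ofReal_le_ofReal
    have := norm_add_le (a ω) (b ω)
    nlinarith [norm_nonneg (a ω + b ω), sq_nonneg (‖a ω‖ - ‖b ω‖)]
  calc ∫⁻ ω, ‖a ω + b ω‖ₑ ^ 2 ∂P ≤ ∫⁻ ω, (2 * ‖a ω‖ₑ ^ 2 + 2 * ‖b ω‖ₑ ^ 2) ∂P :=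
        lintegral_mono hpt
    _ = 2 * ∫⁻ ω, ‖a ω‖ₑ ^ 2 ∂P + 2 * ∫⁻ ω, ‖b ω‖ₑ ^ 2 ∂P := by
        rw [lintegral_add_left (by fun_prop), lintegral_const_mul _ (by fun_prop),
          lintegral_const_mul _ (by fun_prop)]
    _ ≤ 2 * ∫⁻ ω, ‖a ω - b ω‖ₑ ^ 2 ∂P + 2 * ∫⁻ ω, ‖a ω - b ω‖ₑ ^ 2 ∂P := by gcongr
    _ = _ := by rw [← add_mul]; norm_num

/-- Average the sign change inequality over all signs, then use the Rademacher bound for the vectors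
`X i ω` at each fixed `ω`. -/
lemma RademacherTypeTwoWith.typeTwoWith {c : ℝ} (h : RademacherTypeTwoWith B c) :
    TypeTwoWith B (4 * c) := by
  intro Ω _ P _ n X hX hind h2 h0
  have hi2 : ∀ i, Integrable (fun ω => ‖X i ω‖ ^ 2) P := fun i => (h2 i).norm.integrable_sq
  have hmem : ∀ ε : Fin n → ℤˣ, MemLp (fun ω => ∑ i, ((ε i : ℤ) : ℝ) • X i ω) 2 P := fun ε =>
    memLp_finsetSum _ fun i _ => (h2 i).const_smul _
  have hmem1 : MemLp (fun ω => ∑ i, X i ω) 2 P := memLp_finsetSum _ fun i _ => h2 i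
  have hstep : ∀ ε : Fin n → ℤˣ, ∫ ω, ‖∑ i, X i ω‖ ^ 2 ∂P ≤
      4 * ∫ ω, ‖∑ i, ((ε i : ℤ) : ℝ) • X i ω‖ ^ 2 ∂P := fun ε => by
    have := lintegral_enorm_sq_sum_le_signed hX hind
      (fun i => (h2 i).integrable one_le_two) h0 ε
    rwa [lintegral_enorm_sq_eq_ofReal hmem1, lintegral_enorm_sq_eq_ofReal (hmem ε),
      ← ENNReal.ofReal_ofNat 4, ← ENNReal.ofReal_mul (by norm_num),
      ENNReal.ofReal_le_ofReal_iff
        (mul_nonneg (by norm_num) (integral_nonneg fun _ => by positivity))] at this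
  set N : ℝ := (Fintype.card (Fin n → ℤˣ) : ℝ) with hN
  have hNpos : 0 < N := by
    rw [hN]
    exact_mod_cast Fintype.card_pos
  have hsum := Finset.sum_le_sum fun (ε : Fin n → ℤˣ) (_ : ε ∈ Finset.univ) => hstep ε
  rw [Finset.sum_const, Finset.card_univ, nsmul_eq_mul, ← hN, ← Finset.mul_sum,
    ← integral_finsetSum _ fun ε _ => (hmem ε).norm.integrable_sq] at hsum
  have hbound : ∫ ω, ∑ ε : Fin n → ℤˣ, ‖∑ i, ((ε i : ℤ) : ℝ) • X i ω‖ ^ 2 ∂P ≤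
      N * (c * ∑ i, ∫ ω, ‖X i ω‖ ^ 2 ∂P) := by
    rw [← integral_finsetSum _ fun i _ => hi2 i, ← integral_const_mul, ← integral_const_mul]
    exact integral_mono (integrable_finsetSum _ fun ε _ => (hmem ε).norm.integrable_sq)
      (((integrable_finsetSum _ fun i _ => hi2 i).const_mul c).const_mul N)
      fun ω => h n fun i => X i ω
  refine le_of_mul_le_mul_left (hsum.trans ?_) hNpos
  calc _ ≤ 4 * (N * (c * ∑ i, ∫ ω, ‖X i ω‖ ^ 2 ∂P)) := by gcongr
    _ = _ := by ring

end Symmetrization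

/-! ### Uniform signed indices, on a sample space living in the universe `u` that the conditions
quantify over. -/

section SignedIndex

/-- A signed index, the sample space of one step of the walk with steps `± x j`. -/
@[ext]
structure SignedIndex (n : ℕ) : Type u where
  /-- The index. -/
  index : Fin n
  /-- The sign. -/
  sign : ℤˣ

/-- Signed indices are pairs. -/
def signedIndexEquiv (n : ℕ) : Fin n × ℤˣ ≃ SignedIndex.{u} n where
  toFun z := ⟨z.1, z.2⟩
  invFun z := (z.index, z.sign)

instance (n : ℕ) : Fintype (SignedIndex.{u} n) := Fintype.ofEquiv _ (signedIndexEquiv n)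

instance (n : ℕ) [NeZero n] : Nonempty (SignedIndex.{u} n) := ⟨⟨0, 1⟩⟩

instance (n : ℕ) : MeasurableSpace (SignedIndex.{u} n) := ⊤

instance (n : ℕ) : DiscreteMeasurableSpace (SignedIndex.{u} n) := ⟨fun _ => trivial⟩

/-- The uniform distribution of a signed index. -/
def signedUniform (n : ℕ) [NeZero n] : Measure (SignedIndex.{u} n) :=
  (PMF.uniformOfFintype (SignedIndex.{u} n)).toMeasure

instance (n : ℕ) [NeZero n] : IsProbabilityMeasure (signedUniform.{u} n) :=
  inferInstanceAs (IsProbabilityMeasure (PMF.toMeasure _))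

variable {n : ℕ} [NeZero n]

lemma integral_signedUniform {E : Type*} [NormedAddCommGroup E] [NormedSpace ℝ E] [CompleteSpace E]
    (f : SignedIndex.{u} n → E) :
    ∫ z, f z ∂(signedUniform n) =
      (2 * n : ℝ)⁻¹ • ∑ j : Fin n, (f ⟨j, 1⟩ + f ⟨j, -1⟩) := by
  have hcard : Fintype.card (SignedIndex.{u} n) = n * 2 := by
    rw [← Fintype.card_congr (signedIndexEquiv.{u} n)]
    simp [Fintype.card_units_int]
  rw [signedUniform, PMF.integral_eq_sum]
  simp only [PMF.uniformOfFintype_apply, hcard]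
  rw [← Finset.smul_sum]
  congr 1
  · simp [mul_comm]
  · rw [← (signedIndexEquiv.{u} n).sum_comp, Fintype.sum_prod_type]
    refine Finset.sum_congr rfl fun j _ => ?_
    rw [UnitsInt.univ, Finset.sum_pair (by decide)]
    rfl

/-- Source of both symmetries used later, under sign flips and under transpositions of indices. -/
lemma map_signedUniform (e : SignedIndex.{u} n ≃ SignedIndex.{u} n) :
    (signedUniform n).map e = signedUniform n := by
  ext s _
  rw [Measure.map_apply (measurable_of_countable _) (.of_discrete)]
  classical
  rw [signedUniform, PMF.toMeasure_uniformOfFintype_apply _ .of_discrete,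
    PMF.toMeasure_uniformOfFintype_apply _ .of_discrete]
  congr 2
  exact Fintype.card_congr (e.subtypeEquiv fun _ => Iff.rfl)

/-- Multiplying the sign attached to the index `j` by `ε j`. -/
def flipSigns (ε : Fin n → ℤˣ) : SignedIndex.{u} n ≃ SignedIndex.{u} n where
  toFun z := ⟨z.index, ε z.index * z.sign⟩
  invFun z := ⟨z.index, ε z.index * z.sign⟩
  left_inv z := by ext <;> simp [← mul_assoc, Int.units_mul_self]
  right_inv z := by ext <;> simp [← mul_assoc, Int.units_mul_self]

/-- The signed indicator of the index `j`. -/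
def signedIndicator (j : Fin n) (z : SignedIndex.{u} n) : ℝ :=
  if z.index = j then ((z.sign : ℤ) : ℝ) else 0

lemma abs_signedIndicator_le (j : Fin n) (z : SignedIndex.{u} n) : |signedIndicator j z| ≤ 1 := by
  unfold signedIndicator
  split_ifs
  · rcases units_eq_one_or_neg_one z.sign with h | h <;> simp [h]
  · simp

lemma signedIndicator_flipSigns (ε : Fin n → ℤˣ) (j : Fin n) (z : SignedIndex.{u} n) :
    signedIndicator j (flipSigns ε z) = ((ε j : ℤ) : ℝ) * signedIndicator j z := by
  unfold signedIndicator flipSigns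
  simp only [Equiv.coe_fn_mk]
  split_ifs with h
  · simp [h]
  · simp

lemma integral_signedIndicator (j : Fin n) :
    ∫ z, signedIndicator j z ∂(signedUniform.{u} n) = 0 := by
  rw [integral_signedUniform]
  simp [signedIndicator, Finset.sum_add_distrib]

lemma integral_signedIndicator_sq (j : Fin n) :
    ∫ z, signedIndicator j z ^ 2 ∂(signedUniform.{u} n) = (n : ℝ)⁻¹ := by
  rw [integral_signedUniform]
  simp [signedIndicator, Finset.sum_add_distrib]
  ring

end SignedIndex

/-! ### The walk with steps `± x j`, and the return to type 2. -/

section SignedWalk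

variable {n : ℕ} [NeZero n]

/-- Relabelling the index by a transposition. -/
def swapIndex (j k : Fin n) : SignedIndex.{u} n ≃ SignedIndex.{u} n where
  toFun z := ⟨Equiv.swap j k z.index, z.sign⟩
  invFun z := ⟨Equiv.swap j k z.index, z.sign⟩
  left_inv z := by ext <;> simp
  right_inv z := by ext <;> simp

lemma signedIndicator_swapIndex (j k : Fin n) (z : SignedIndex.{u} n) :
    signedIndicator j (swapIndex j k z) = signedIndicator k z := by
  unfold signedIndicator swapIndex
  simp [Equiv.swap_apply_eq_iff]

/-- The law of a sequence of independent uniform signed indices. -/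
def signedLaw (n : ℕ) [NeZero n] : Measure (ℕ → SignedIndex.{u} n) :=
  Measure.infinitePi fun _ => signedUniform.{u} n

instance : IsProbabilityMeasure (signedLaw.{u} n) :=
  inferInstanceAs (IsProbabilityMeasure (Measure.infinitePi _))

lemma measurePreserving_signedLaw (e : SignedIndex.{u} n ≃ SignedIndex.{u} n) :
    MeasurePreserving (fun ω i => e (ω i)) (signedLaw.{u} n) (signedLaw.{u} n) where
  measurable := measurable_pi_lambda _ fun i =>
    (measurable_of_countable e).comp (measurable_pi_apply i)
  map_eq := by
    unfold signedLaw
    rw [Measure.infinitePi_map_pi (fun _ => signedUniform.{u} n) fun _ => measurable_of_countable e]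
    simp_rw [map_signedUniform]

lemma measurePreserving_eval_signedLaw (i : ℕ) :
    MeasurePreserving (fun ω : ℕ → SignedIndex.{u} n => ω i) (signedLaw.{u} n) (signedUniform.{u} n) :=
  measurePreserving_eval_infinitePi _ i

lemma integral_eval_signedLaw {E : Type*} [NormedAddCommGroup E] [NormedSpace ℝ E]
    (f : SignedIndex.{u} n → E) (i : ℕ) :
    ∫ ω, f (ω i) ∂(signedLaw.{u} n) = ∫ z, f z ∂(signedUniform.{u} n) := by
  have h := measurePreserving_eval_signedLaw.{u} (n := n) i
  rw [← h.map_eq, integral_map h.measurable.aemeasurable]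
  exact (StronglyMeasurable.of_discrete).aestronglyMeasurable

lemma iIndepFun_signedLaw {E : Type*} [MeasurableSpace E] (f : SignedIndex.{u} n → E) :
    iIndepFun (fun (i : ℕ) ω => f (ω i)) (signedLaw.{u} n) :=
  iIndepFun_infinitePi (X := fun _ => f) fun _ => measurable_of_countable f

lemma measurable_eval_signed {E : Type*} [MeasurableSpace E] (f : SignedIndex.{u} n → E) (i : ℕ) :
    Measurable fun ω : ℕ → SignedIndex.{u} n => f (ω i) :=
  (measurable_of_countable f).comp (measurable_pi_apply i)

/-- The signed number of visits to the index `j` before time `m`. -/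
def signedCount (j : Fin n) (m : ℕ) (ω : ℕ → SignedIndex.{u} n) : ℝ :=
  ∑ i ∈ Finset.range m, signedIndicator j (ω i)

lemma measurable_signedCount (j : Fin n) (m : ℕ) : Measurable (signedCount.{u} j m) :=
  Finset.measurable_fun_sum _ fun i _ => measurable_eval_signed _ i

lemma abs_signedCount_le (j : Fin n) (m : ℕ) (ω : ℕ → SignedIndex.{u} n) :
    |signedCount j m ω| ≤ m := by
  refine (Finset.abs_sum_le_sum_abs _ _).trans ?_
  simpa using Finset.sum_le_card_nsmul (Finset.range m) _ 1
    fun i _ => abs_signedIndicator_le j (ω i)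

lemma integrable_abs_signedCount (j : Fin n) (m : ℕ) :
    Integrable (fun ω => |signedCount.{u} j m ω|) (signedLaw.{u} n) :=
  Integrable.of_bound (measurable_signedCount j m).abs.aestronglyMeasurable m
    (ae_of_all _ fun ω => by simpa using abs_signedCount_le j m ω)

/-- Indices are exchangeable; the common mean can then be pulled out of a sum over `j`. -/
lemma integral_abs_signedCount_eq (j k : Fin n) (m : ℕ) :
    ∫ ω, |signedCount.{u} j m ω| ∂(signedLaw.{u} n) = ∫ ω, |signedCount k m ω| ∂(signedLaw.{u} n) := by
  have h := measurePreserving_signedLaw.{u} (swapIndex j k)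
  conv_lhs => rw [← h.map_eq]
  rw [integral_map h.measurable.aemeasurable
    (measurable_signedCount j m).abs.aestronglyMeasurable]
  simp [signedCount, signedIndicator_swapIndex]

lemma le_integral_abs_signedCount (j : Fin n) {m : ℕ} (hm : n ≤ m) :
    3 / 8 * √(m / n) ≤ ∫ ω, |signedCount.{u} j m ω| ∂(signedLaw.{u} n) := by
  have hn : (0 : ℝ) < n := by exact_mod_cast Nat.pos_of_ne_zero (NeZero.ne n)
  have hmn : (n : ℝ) ≤ m := by exact_mod_cast hm
  -- With `q = m / n ≥ 1`, the fourth moment bound `q + 3 q²` is at most `4 q²`.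
  have hq : 1 ≤ (m : ℝ) / n := (one_le_div hn).2 hmn
  obtain ⟨-, h2, h4⟩ := moments_sum_range (P := signedLaw.{u} n)
    (ξ := fun i ω => signedIndicator j (ω i)) (fun i => measurable_eval_signed _ i)
    (iIndepFun_signedLaw _) (fun i ω => abs_signedIndicator_le j (ω i))
    (fun i => (integral_eval_signedLaw _ i).trans (integral_signedIndicator j))
    (p := (n : ℝ)⁻¹)
    (fun i => (integral_eval_signedLaw (fun z => signedIndicator j z ^ 2) i).trans
      (integral_signedIndicator_sq j)) m
  rw [← div_eq_mul_inv] at h2 h4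
  refine integral_abs_ge_of_moments (measurable_signedCount j m) (abs_signedCount_le j m)
    (by linarith) h2 (h4.trans ?_)
  nlinarith

variable {B : Type u} [NormedAddCommGroup B] [NormedSpace ℝ B]

/-- The step of the walk attached to a signed index. -/
def signedStep (x : Fin n → B) (z : SignedIndex.{u} n) : B := ((z.sign : ℤ) : ℝ) • x z.index

lemma norm_signedStep (x : Fin n → B) (z : SignedIndex.{u} n) :
    ‖signedStep x z‖ = ‖x z.index‖ := by
  unfold signedStep
  rcases units_eq_one_or_neg_one z.sign with h | h <;> simp [h]

lemma norm_signedStep_le (x : Fin n → B) (z : SignedIndex.{u} n) :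
    ‖signedStep x z‖ ≤ ∑ j, ‖x j‖ := by
  rw [norm_signedStep]
  exact Finset.single_le_sum (f := fun j => ‖x j‖) (fun _ _ => norm_nonneg _) (Finset.mem_univ _)

lemma signedStep_eq_sum (x : Fin n → B) (z : SignedIndex.{u} n) :
    signedStep x z = ∑ j, signedIndicator j z • x j := by
  simp [signedStep, signedIndicator, ite_smul]

/-- The walk with independent steps `± x j`. -/
def signedWalk (x : Fin n → B) (i : ℕ) (ω : ℕ → SignedIndex.{u} n) : B := signedStep x (ω i)

lemma partialSum_signedWalk (x : Fin n → B) (m : ℕ) (ω : ℕ → SignedIndex.{u} n) :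
    partialSum (signedWalk x) m ω = ∑ j, signedCount j m ω • x j := by
  simp only [partialSum, signedWalk, signedStep_eq_sum, signedCount, Finset.sum_smul]
  exact Finset.sum_comm

lemma partialSum_signedWalk_flipSigns (x : Fin n → B) (ε : Fin n → ℤˣ) (m : ℕ)
    (ω : ℕ → SignedIndex.{u} n) :
    partialSum (signedWalk x) m (fun i => flipSigns ε (ω i)) =
      ∑ j, ((ε j : ℤ) : ℝ) • signedCount j m ω • x j := by
  rw [partialSum_signedWalk]
  simp only [signedCount, signedIndicator_flipSigns, ← Finset.mul_sum, mul_smul]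

variable [CompleteSpace B] [MeasurableSpace B] [BorelSpace B] [SecondCountableTopology B]

lemma integral_norm_sq_signedWalk (x : Fin n → B) (i : ℕ) :
    ∫ ω, ‖signedWalk x i ω‖ ^ 2 ∂(signedLaw.{u} n) = (n : ℝ)⁻¹ * ∑ j, ‖x j‖ ^ 2 := by
  unfold signedWalk
  rw [integral_eval_signedLaw (fun z => ‖signedStep x z‖ ^ 2), integral_signedUniform]
  simp [norm_signedStep, Finset.sum_add_distrib]
  ring

lemma isCenteredStepSequence_signedWalk {x : Fin n → B} (hx : x ≠ 0) :
    IsCenteredStepSequence (signedLaw.{u} n) (signedWalk x) where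
  measurable i := measurable_eval_signed _ i
  indep := iIndepFun_signedLaw _
  identDistrib i :=
    { aemeasurable_fst := (measurable_eval_signed _ i).aemeasurable
      aemeasurable_snd := (measurable_eval_signed _ 0).aemeasurable
      map_eq := by
        have h : ∀ i, (signedLaw.{u} n).map (signedWalk x i) =
            (signedUniform.{u} n).map (signedStep x) := fun i => by
          rw [← (measurePreserving_eval_signedLaw i).map_eq,
            Measure.map_map (measurable_of_countable _)
              (measurePreserving_eval_signedLaw i).measurable]
          rfl
        rw [h, h] }
  nondegenerate h := by
    have h0 : ∫ ω, ‖signedWalk x 0 ω‖ ^ 2 ∂(signedLaw.{u} n) = 0 := by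
      rw [integral_eq_zero_of_ae]
      filter_upwards [h] with ω hω
      simp [hω]
    rw [integral_norm_sq_signedWalk] at h0
    have hn : (n : ℝ)⁻¹ ≠ 0 := inv_ne_zero (by exact_mod_cast NeZero.ne n)
    have h1 := (mul_eq_zero.1 h0).resolve_left hn
    rw [Finset.sum_eq_zero_iff_of_nonneg fun _ _ => by positivity] at h1
    exact hx (funext fun j => by simpa using h1 j (Finset.mem_univ j))
  memLp := memLp_of_norm_le (measurable_eval_signed _ 0) fun ω => norm_signedStep_le x (ω 0)
  mean_zero := by
    unfold signedWalk
    rw [integral_eval_signedLaw, integral_signedUniform]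
    simp [signedStep]

/-- Second moments of the walk dominate Rademacher averages. -/
lemma sum_enorm_sq_le_lintegral_signedWalk (x : Fin n → B) (k : Fin n) (m : ℕ) :
    ∑ ε : Fin n → ℤˣ, ‖(∫ ω, |signedCount.{u} k m ω| ∂(signedLaw.{u} n)) •
        ∑ j, ((ε j : ℤ) : ℝ) • x j‖ₑ ^ 2 ≤
      Fintype.card (Fin n → ℤˣ) *
        ∫⁻ ω, ‖partialSum (signedWalk x) m ω‖ₑ ^ 2 ∂(signedLaw.{u} n) := by
  have hS : Measurable (partialSum (signedWalk.{u} x) m) :=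
    measurable_partialSum (fun i => measurable_eval_signed _ i) m
  have hc : ∀ j : Fin n, Measurable (signedCount.{u} j m) := fun j => measurable_signedCount j m
  have hfm : ∀ ε : Fin n → ℤˣ, Measurable fun ω : ℕ → SignedIndex.{u} n =>
      ∑ j, ((ε j : ℤ) : ℝ) • signedCount j m ω • x j := fun ε =>
    Finset.measurable_fun_sum _ fun j _ => ((hc j).smul_const _).const_smul _
  have hgm : ∀ ε : Fin n → ℤˣ, Measurable fun ω : ℕ → SignedIndex.{u} n =>
      ∑ j, ((ε j : ℤ) : ℝ) • |signedCount j m ω| • x j := fun ε =>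
    Finset.measurable_fun_sum _ fun j _ => ((hc j).abs.smul_const _).const_smul _
  have hflip : ∀ ε : Fin n → ℤˣ,
      ∫⁻ ω, ‖partialSum (signedWalk x) m ω‖ₑ ^ 2 ∂(signedLaw.{u} n) =
        ∫⁻ ω, ‖∑ j, ((ε j : ℤ) : ℝ) • signedCount j m ω • x j‖ₑ ^ 2 ∂(signedLaw.{u} n) := fun ε => by
    rw [← (measurePreserving_signedLaw (flipSigns ε)).lintegral_comp (hS.enorm.pow_const 2)]
    simp only [partialSum_signedWalk_flipSigns]
  have hmean : ∀ ε : Fin n → ℤˣ, (∫ ω, |signedCount.{u} k m ω| ∂(signedLaw.{u} n)) •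
      ∑ j, ((ε j : ℤ) : ℝ) • x j =
        ∫ ω, ∑ j, ((ε j : ℤ) : ℝ) • |signedCount j m ω| • x j ∂(signedLaw.{u} n) := fun ε => by
    rw [integral_finsetSum _ fun j _ => ((integrable_abs_signedCount j m).smul_const _).fun_smul _,
      Finset.smul_sum]
    refine Finset.sum_congr rfl fun j _ => ?_
    rw [integral_smul, integral_smul_const, integral_abs_signedCount_eq j k, smul_comm]
  -- Jensen must be applied to `|N_j|`, since `N_j` itself has mean zero. The passage from `|N_j|`
  -- to `N_j` holds only after summing over all `ε`, and `hflip` then makes all summands equal.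
  calc _ ≤ ∑ ε : Fin n → ℤˣ,
        ∫⁻ ω, ‖∑ j, ((ε j : ℤ) : ℝ) • |signedCount j m ω| • x j‖ₑ ^ 2 ∂(signedLaw.{u} n) := by
        refine Finset.sum_le_sum fun ε _ => ?_
        rw [hmean]
        refine le_trans ?_ (lintegral_sq_le _ (hgm ε).enorm.aemeasurable)
        gcongr
        exact enorm_integral_le_lintegral_enorm _
    _ = ∑ ε : Fin n → ℤˣ,
        ∫⁻ ω, ‖∑ j, ((ε j : ℤ) : ℝ) • signedCount j m ω • x j‖ₑ ^ 2 ∂(signedLaw.{u} n) := by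
        rw [← lintegral_finsetSum _ fun ε _ => (hgm ε).enorm.pow_const 2,
          ← lintegral_finsetSum _ fun ε _ => (hfm ε).enorm.pow_const 2]
        congr 1 with ω
        exact sum_signs_abs (fun b => ‖b‖ₑ ^ 2) x fun j => signedCount j m ω
    _ = _ := by
        simp only [← hflip]
        simp

lemma AsymptoticExpectationBound.rademacherTypeTwoWith {c : ℝ} (hc : 0 < c)
    (h : AsymptoticExpectationBound B c) : RademacherTypeTwoWith B (3072 / c) := by
  intro n x
  -- The zero family, which includes `n = 0`, gives a degenerate walk and is excluded from (iv).
  by_cases hx : x = 0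
  · simp [hx]
  have hne : n ≠ 0 := by
    rintro rfl
    exact hx (Subsingleton.elim _ _)
  have : NeZero n := ⟨hne⟩
  have hn : (0 : ℝ) < n := by exact_mod_cast Nat.pos_of_ne_zero hne
  have hev := h.lintegral_enorm_sq_le hc (signedLaw.{u} n) (isCenteredStepSequence_signedWalk hx)
    fun i ω => norm_signedStep_le x (ω i)
  obtain ⟨m, hm, hmn⟩ := (hev.and (eventually_ge_atTop n)).exists
  have hm0 : (0 : ℝ) < m := by exact_mod_cast (Nat.pos_of_ne_zero hne).trans_le hmn
  have h1 := sum_enorm_sq_le_lintegral_signedWalk x 0 m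
  have ha := le_integral_abs_signedCount.{u} (0 : Fin n) hmn
  set a := ∫ ω, |signedCount.{u} (0 : Fin n) m ω| ∂(signedLaw.{u} n)
  set N : ℝ := (Fintype.card (Fin n → ℤˣ) : ℝ) with hN
  set R := ∑ ε : Fin n → ℤˣ, ‖∑ i, ((ε i : ℤ) : ℝ) • x i‖ ^ 2 with hR
  have hR0 : 0 ≤ R := Finset.sum_nonneg fun _ _ => by positivity
  have hleft : ∑ ε : Fin n → ℤˣ, ‖a • ∑ j, ((ε j : ℤ) : ℝ) • x j‖ₑ ^ 2 =
      ENNReal.ofReal (a ^ 2 * R) := by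
    rw [hR, Finset.mul_sum, ENNReal.ofReal_sum_of_nonneg fun _ _ => by positivity]
    refine Finset.sum_congr rfl fun ε _ => ?_
    rw [← ofReal_norm, ← ENNReal.ofReal_pow (norm_nonneg _), norm_smul, mul_pow, Real.norm_eq_abs,
      sq_abs]
  have h2 : ENNReal.ofReal (a ^ 2 * R) ≤
      ENNReal.ofReal (N * (432 * m * ((n : ℝ)⁻¹ * ∑ j, ‖x j‖ ^ 2) / c)) := by
    rw [← hleft, ENNReal.ofReal_mul (by positivity), hN, ENNReal.ofReal_natCast,
      ← integral_norm_sq_signedWalk.{u} x 0]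
    exact h1.trans (by gcongr)
  rw [ENNReal.ofReal_le_ofReal_iff (by positivity)] at h2
  -- The factor `m / n` appears on both sides and cancels, leaving `432 · 64 / 9 = 3072`.
  have ha2 : 9 / 64 * (m / n) ≤ a ^ 2 := by
    calc 9 / 64 * ((m : ℝ) / n) = (3 / 8 * √(m / n)) ^ 2 := by
          rw [mul_pow, Real.sq_sqrt (by positivity)]; norm_num
      _ ≤ a ^ 2 := by gcongr
  have h3 : 9 / 64 * (m / n) * R ≤ 9 / 64 * (m / n) * (N * (3072 / c * ∑ i, ‖x i‖ ^ 2)) := by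
    calc 9 / 64 * (m / n) * R ≤ a ^ 2 * R := by gcongr
      _ ≤ _ := h2
      _ = _ := by field_simp; ring
  exact le_of_mul_le_mul_left h3 (by positivity)

end SignedWalk

/-! ### Composition of the implications, with constants independent of the space. -/

section Equivalence

lemma condition_imp_of_chain {i j k : Fin 5}
    (hij : ∀ c : ℝ, 0 < c → ∃ C : ℝ, 0 < C ∧
      ∀ (B : Type u) [NormedAddCommGroup B] [NormedSpace ℝ B] [CompleteSpace B]
        [TopologicalSpace.SeparableSpace B] [MeasurableSpace B] [BorelSpace B],
        condition B i c → condition B j C)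
    (hjk : ∀ c : ℝ, 0 < c → ∃ C : ℝ, 0 < C ∧
      ∀ (B : Type u) [NormedAddCommGroup B] [NormedSpace ℝ B] [CompleteSpace B]
        [TopologicalSpace.SeparableSpace B] [MeasurableSpace B] [BorelSpace B],
        condition B j c → condition B k C) :
    ∀ c : ℝ, 0 < c → ∃ C : ℝ, 0 < C ∧
      ∀ (B : Type u) [NormedAddCommGroup B] [NormedSpace ℝ B] [CompleteSpace B]
        [TopologicalSpace.SeparableSpace B] [MeasurableSpace B] [BorelSpace B],
        condition B i c → condition B k C := by
  intro c hc
  obtain ⟨C, hC, h1⟩ := hij c hc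
  obtain ⟨D, hD, h2⟩ := hjk C hC
  exact ⟨D, hD, fun B => fun h => h2 B (h1 B h)⟩

/-- Each of the five conditions implies each other one, with constants that do not depend on the
space. -/
lemma condition_imp (i j : Fin 5) : ∀ c : ℝ, 0 < c → ∃ C : ℝ, 0 < C ∧
    ∀ (B : Type u) [NormedAddCommGroup B] [NormedSpace ℝ B] [CompleteSpace B]
      [TopologicalSpace.SeparableSpace B] [MeasurableSpace B] [BorelSpace B],
      condition B i c → condition B j C := by
  -- The indices `0, …, 4` stand for (i) to (v). The arrows `0 → 2 → 1 → 3 → 0` and `2 → 4 → 3`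
  -- connect every pair through `0`.
  have h02 : ∀ c : ℝ, 0 < c → ∃ C : ℝ, 0 < C ∧
      ∀ (B : Type u) [NormedAddCommGroup B] [NormedSpace ℝ B] [CompleteSpace B]
        [TopologicalSpace.SeparableSpace B] [MeasurableSpace B] [BorelSpace B],
        condition B 0 c → condition B 2 C := fun c hc =>
    ⟨3 + 16 * c, by positivity, fun B => fun h =>
      have := UniformSpace.secondCountable_of_separable B
      TypeTwoWith.probabilityBound hc h⟩
  have h21 : ∀ c : ℝ, 0 < c → ∃ C : ℝ, 0 < C ∧
      ∀ (B : Type u) [NormedAddCommGroup B] [NormedSpace ℝ B] [CompleteSpace B]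
        [TopologicalSpace.SeparableSpace B] [MeasurableSpace B] [BorelSpace B],
        condition B 2 c → condition B 1 C := fun c hc =>
    ⟨1 / (4 * c), by positivity, fun B => fun h =>
      have := UniformSpace.secondCountable_of_separable B
      ProbabilityBound.expectationBound hc h⟩
  have h13 : ∀ c : ℝ, 0 < c → ∃ C : ℝ, 0 < C ∧
      ∀ (B : Type u) [NormedAddCommGroup B] [NormedSpace ℝ B] [CompleteSpace B]
        [TopologicalSpace.SeparableSpace B] [MeasurableSpace B] [BorelSpace B],
        condition B 1 c → condition B 3 C := fun c hc =>
    ⟨c / 2, by positivity, fun B => fun h =>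
      have := UniformSpace.secondCountable_of_separable B
      ExpectationBound.asymptotic hc h⟩
  have h24 : ∀ c : ℝ, 0 < c → ∃ C : ℝ, 0 < C ∧
      ∀ (B : Type u) [NormedAddCommGroup B] [NormedSpace ℝ B] [CompleteSpace B]
        [TopologicalSpace.SeparableSpace B] [MeasurableSpace B] [BorelSpace B],
        condition B 2 c → condition B 4 C := fun c hc =>
    ⟨2 * c, by positivity, fun B => fun h =>
      have := UniformSpace.secondCountable_of_separable B
      ProbabilityBound.asymptotic hc h⟩
  have h43 : ∀ c : ℝ, 0 < c → ∃ C : ℝ, 0 < C ∧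
      ∀ (B : Type u) [NormedAddCommGroup B] [NormedSpace ℝ B] [CompleteSpace B]
        [TopologicalSpace.SeparableSpace B] [MeasurableSpace B] [BorelSpace B],
        condition B 4 c → condition B 3 C := fun c hc =>
    ⟨1 / (8 * c), by positivity, fun B => fun h =>
      have := UniformSpace.secondCountable_of_separable B
      AsymptoticProbabilityBound.asymptoticExpectationBound hc h⟩
  have h30 : ∀ c : ℝ, 0 < c → ∃ C : ℝ, 0 < C ∧
      ∀ (B : Type u) [NormedAddCommGroup B] [NormedSpace ℝ B] [CompleteSpace B]
        [TopologicalSpace.SeparableSpace B] [MeasurableSpace B] [BorelSpace B],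
        condition B 3 c → condition B 0 C := fun c hc =>
    ⟨4 * (3072 / c), by positivity, fun B => fun h =>
      have := UniformSpace.secondCountable_of_separable B
      (AsymptoticExpectationBound.rademacherTypeTwoWith hc h).typeTwoWith⟩
  have h20 := condition_imp_of_chain (condition_imp_of_chain h21 h13) h30
  have h10 := condition_imp_of_chain h13 h30
  have h40 := condition_imp_of_chain h43 h30
  have h01 := condition_imp_of_chain h02 h21
  have h03 := condition_imp_of_chain h01 h13
  have h04 := condition_imp_of_chain h02 h24
  have h00 := condition_imp_of_chain h01 h10
  have hto : ∀ c : ℝ, 0 < c → ∃ C : ℝ, 0 < C ∧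
      ∀ (B : Type u) [NormedAddCommGroup B] [NormedSpace ℝ B] [CompleteSpace B]
        [TopologicalSpace.SeparableSpace B] [MeasurableSpace B] [BorelSpace B],
        condition B i c → condition B 0 C := by
    fin_cases i
    exacts [h00, h10, h20, h30, h40]
  have hfrom : ∀ c : ℝ, 0 < c → ∃ C : ℝ, 0 < C ∧
      ∀ (B : Type u) [NormedAddCommGroup B] [NormedSpace ℝ B] [CompleteSpace B]
        [TopologicalSpace.SeparableSpace B] [MeasurableSpace B] [BorelSpace B],
        condition B 0 c → condition B j C := by
    fin_cases j
    exacts [h00, h01, h02, h03, h04]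
  exact condition_imp_of_chain hto hfrom

end Equivalence

end

end RandomWalkExit

theorem theorem3p1 :
    -- the five conditions are equivalent for every separable Banach space
    (∀ (B : Type u) [NormedAddCommGroup B] [NormedSpace ℝ B] [CompleteSpace B]
        [TopologicalSpace.SeparableSpace B] [MeasurableSpace B] [BorelSpace B],
      List.TFAE [
        RandomWalkExit.IsTypeTwo B,
        ∃ c : ℝ, 0 < c ∧ RandomWalkExit.ExpectationBound B c,
        ∃ c : ℝ, 0 < c ∧ RandomWalkExit.ProbabilityBound B c,
        ∃ c : ℝ, 0 < c ∧ RandomWalkExit.AsymptoticExpectationBound B c,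
        ∃ c : ℝ, 0 < c ∧ RandomWalkExit.AsymptoticProbabilityBound B c]) ∧
    -- the constants depend only on each other (and not on the space)
    (∀ (i j : Fin 5) (c : ℝ), 0 < c → ∃ C : ℝ, 0 < C ∧
      ∀ (B : Type u) [NormedAddCommGroup B] [NormedSpace ℝ B] [CompleteSpace B]
        [TopologicalSpace.SeparableSpace B] [MeasurableSpace B] [BorelSpace B],
        RandomWalkExit.condition B i c → RandomWalkExit.condition B j C) := by
  refine ⟨fun B => ?_, RandomWalkExit.condition_imp⟩
  intros
  have key : ∀ i j : Fin 5, (∃ c : ℝ, 0 < c ∧ RandomWalkExit.condition B i c) →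
      ∃ c : ℝ, 0 < c ∧ RandomWalkExit.condition B j c := by
    rintro i j ⟨c, hc, h⟩
    obtain ⟨C, hC, hi⟩ := RandomWalkExit.condition_imp i j c hc
    exact ⟨C, hC, hi B h⟩
  tfae_have 1 → 2 := key 0 1
  tfae_have 2 → 3 := key 1 2
  tfae_have 3 → 4 := key 2 3
  tfae_have 4 → 5 := key 3 4
  tfae_have 5 → 1 := key 4 0
  tfae_finish
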